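/- Let $G=(V,E)$ be an arbitrary simple graph (of any cardinality, not necessarily connected or locally finite). A ray is a one-way infinite path in $G$. Two rays are equivalent if no finite set of vertices separates them, and the ends of $G$ are the equivalence classes; $\Omega(G)$ is the set of ends. For finite $X\subseteq V$ and $\omega\in\Omega(G)$ let $C(X,\omega)$ be the unique component of $G-X$ that contains a tail of every ray in $\omega$, and let $\Omega(X,\omega)=\{\eta\in\Omega(G): C(X,\eta)=C(X,\omega)\}$. Let $|G|=G\cup\Omega(G)$, where $G$ is regarded as the set of points of the corresponding $1$-complex (all vertices and all points on edges, each edge being a copy of $[0,1]$). Consider the following two topologies on $|G|$. (Top) The topology generated by the open sets of the $1$-complex $G$ (sets whose trace on every edge is open in that edge) together with all sets $$\hat C_*(X,\omega)=C(X,\omega)\cup\Omega(X,\omega)\cup \mathring E_*(X,C(X,\omega)),$$ where $X\subseteq V$ is finite, $\omega\in\Omega(G)$, and $\mathring E_*(X,C(X,\omega))$ is any union of half-open intervals, one from each edge $e$ between $X$ and $C(X,\omega)$, containing the endvertex of $e$ in $C(X,\omega)$ as its closed end. (MTop) The topology generated by the open sets of $G$ as a metric length space, in which every edge has length $1$ and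 the distance between two points is the length of a shortest arc in $G$ between them ($\infty$ if there is none), together with all sets $$\hat C_\varepsilon(X,\omega)=C(X,\omega)\cup\Omega(X,\omega)\cup \mathring E_\varepsilon(X,C(X,\omega)),$$ where $X\subseteq V$ is finite, $\omega\in\Omega(G)$, $\varepsilon>0$, and $\mathring E_\varepsilon(X,C(X,\omega))$ is the open ball of radius $\varepsilon$ around $C(X,\omega)$ in $G$. Then $|G|$ is Hausdorff and paracompact (every open cover has a locally finite open refinement that is again a cover), both in Top and in MTop. -/

import Mathlib

open Filter
open scoped NNReal ENNReal

universe u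

namespace GraphEnds

/-! ### Rays and ends -/

/-- A ray (one-way infinite path) of `G`, given by its vertices in their order along the ray. -/
structure Ray {V : Type u} (G : SimpleGraph V) where
  vertex : ℕ → V
  injective : Function.Injective vertex
  adj : ∀ n, G.Adj (vertex n) (vertex (n + 1))

/-- The vertex set `X` separates `A` from `B` in `G`: every walk (equivalently, every path)
from `A` to `B` meets `X`. -/
def Separates {V : Type u} (G : SimpleGraph V) (X A B : Set V) : Prop :=
  ∀ a ∈ A, ∀ b ∈ B, ∀ p : G.Walk a b, ∃ x ∈ p.support, x ∈ X

/-- Two rays are equivalent if no finite set of vertices separates them. -/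
def Ray.Equivalent {V : Type u} {G : SimpleGraph V} (R S : Ray G) : Prop :=
  ∀ X : Finset V, ¬ Separates G (X : Set V) (Set.range R.vertex) (Set.range S.vertex)

/-- Vertices joined by a walk avoiding `X` lie in the same component of `G - X`. -/
theorem componentComplMk_eq_of_walk {V : Type u} {G : SimpleGraph V} {X : Set V} {a b : V}
    (p : G.Walk a b) (hp : ∀ x ∈ p.support, x ∉ X) (ha : a ∉ X) (hb : b ∉ X) :
    G.componentComplMk ha = G.componentComplMk hb := by
  induction p with
  | nil => rfl
  | cons h q ih =>
    have hv := hp _ (List.mem_cons_of_mem _ q.start_mem_support)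
    exact (SimpleGraph.componentComplMk_eq_of_adj G ha hv h).trans
      (ih (fun x hx => hp x (List.mem_cons_of_mem _ hx)) hv hb)

/-- Vertices in the same component of `G - X` are joined by a walk avoiding `X`. -/
theorem exists_walk_of_componentComplMk_eq {V : Type u} {G : SimpleGraph V} {X : Set V} {a b : V}
    (ha : a ∉ X) (hb : b ∉ X) (h : G.componentComplMk ha = G.componentComplMk hb) :
    ∃ p : G.Walk a b, ∀ x ∈ p.support, x ∉ X := by
  have key : ∀ (u v : (Xᶜ : Set V)), (G.induce Xᶜ).Walk u v →
      ∃ p : G.Walk u v, ∀ x ∈ p.support, x ∉ X := by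
    intro u v q
    induction q with
    | @nil u => exact ⟨.nil, fun x hx => by rw [List.mem_singleton.1 hx]; exact u.2⟩
    | @cons u v w hadj _ ih =>
      obtain ⟨p, hp⟩ := ih
      refine ⟨.cons hadj p, fun x hx => ?_⟩
      rcases List.mem_cons.1 hx with rfl | hx
      · exact u.2
      · exact hp x hx
  obtain ⟨q⟩ := SimpleGraph.ConnectedComponent.exact h
  exact key _ _ q

/-- Every ray has a tail avoiding a given finite set. -/
theorem Ray.eventually_notMem {V : Type u} {G : SimpleGraph V} (R : Ray G) (X : Finset V) :
    ∀ᶠ n in atTop, R.vertex n ∉ X := by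
  have h := R.injective.tendsto_cofinite.eventually X.finite_toSet.compl_mem_cofinite
  rw [Nat.cofinite_eq_atTop] at h
  exact h

/-- Every ray has a tail in some component of `G - X`, for finite `X`. -/
theorem Ray.exists_tail {V : Type u} {G : SimpleGraph V} (R : Ray G) (X : Finset V) :
    ∃ C : G.ComponentCompl (X : Set V), ∀ᶠ n in atTop, R.vertex n ∈ C := by
  obtain ⟨N, hN⟩ := eventually_atTop.1 (R.eventually_notMem X)
  refine ⟨G.componentComplMk (K := (X : Set V)) (by simpa using hN N le_rfl),
    eventually_atTop.2 ⟨N, fun n hn => ?_⟩⟩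
  induction n, hn using Nat.le_induction with
  | base => exact SimpleGraph.componentComplMk_mem _ _
  | succ n hn ih =>
    exact SimpleGraph.ComponentCompl.mem_of_adj _ _ ih
      (by simpa using hN (n + 1) (by omega)) (R.adj n)

theorem component_eq_of_mem {V : Type u} {G : SimpleGraph V} {X : Set V}
    {C D : G.ComponentCompl X} {v : V} (hC : v ∈ C) (hD : v ∈ D) : C = D := by
  obtain ⟨_, rfl⟩ := hC
  obtain ⟨_, rfl⟩ := hD
  rfl

/-- Equivalent rays have tails in the same component of `G - X`, for every finite `X`. -/
theorem Ray.Equivalent.tail {V : Type u} {G : SimpleGraph V} {R S : Ray G} (h : R.Equivalent S)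
    {X : Finset V} {C : G.ComponentCompl (X : Set V)} (hR : ∀ᶠ n in atTop, R.vertex n ∈ C) :
    ∀ᶠ n in atTop, S.vertex n ∈ C := by
  classical
  obtain ⟨D, hS⟩ := S.exists_tail X
  obtain ⟨M, hM⟩ := eventually_atTop.1 hR
  obtain ⟨N, hN⟩ := eventually_atTop.1 hS
  have h1 := h (X ∪ (Finset.range M).image R.vertex ∪ (Finset.range N).image S.vertex)
  simp only [Separates, not_forall] at h1
  obtain ⟨_, ⟨m, rfl⟩, _, ⟨n, rfl⟩, p, hp⟩ := h1
  simp only [not_exists, not_and] at hp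
  have hm : M ≤ m := by
    by_contra hlt
    refine hp _ p.start_mem_support ?_
    simp only [Finset.coe_union, Set.mem_union, Finset.mem_coe, Finset.mem_image]
    exact Or.inl (Or.inr ⟨m, by simpa using hlt, rfl⟩)
  have hn : N ≤ n := by
    by_contra hlt
    refine hp _ p.end_mem_support ?_
    simp only [Finset.coe_union, Set.mem_union, Finset.mem_coe, Finset.mem_image]
    exact Or.inr ⟨n, by simpa using hlt, rfl⟩
  have hX : ∀ x ∈ p.support, x ∉ (X : Set V) := fun x hx hxX => hp x hx (by
    simp only [Finset.coe_union, Set.mem_union]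
    exact Or.inl (Or.inl hxX))
  obtain ⟨h1, e1⟩ := hM m hm
  obtain ⟨h2, e2⟩ := hN n hn
  have : C = D := by rw [← e1, ← e2]; exact componentComplMk_eq_of_walk p hX h1 h2
  rw [this]
  exact hS

/-- Rays with tails in common components of `G - X`, for every finite `X`, are equivalent. -/
theorem Ray.equivalent_of_tail {V : Type u} {G : SimpleGraph V} {R S : Ray G}
    (h : ∀ X : Finset V, ∃ C : G.ComponentCompl (X : Set V),
      (∀ᶠ n in atTop, R.vertex n ∈ C) ∧ ∀ᶠ n in atTop, S.vertex n ∈ C) : R.Equivalent S := by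
  intro X hX
  obtain ⟨C, hR, hS⟩ := h X
  obtain ⟨n, hRn, hSn⟩ := (hR.and hS).exists
  obtain ⟨h1, e1⟩ := hRn
  obtain ⟨h2, e2⟩ := hSn
  obtain ⟨p, hp⟩ := exists_walk_of_componentComplMk_eq h1 h2 (e1.trans e2.symm)
  obtain ⟨x, hx, hxX⟩ := hX _ ⟨n, rfl⟩ _ ⟨n, rfl⟩ p
  exact hp x hx hxX

/-- Equivalence of rays as a setoid. -/
def raySetoid {V : Type u} (G : SimpleGraph V) : Setoid (Ray G) where
  r := Ray.Equivalent
  iseqv :=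
    { refl := fun R => Ray.equivalent_of_tail fun X =>
        let ⟨C, hC⟩ := R.exists_tail X
        ⟨C, hC, hC⟩
      symm := fun {R _} h => Ray.equivalent_of_tail fun X =>
        let ⟨C, hC⟩ := R.exists_tail X
        ⟨C, h.tail hC, hC⟩
      trans := fun {R _ _} h k => Ray.equivalent_of_tail fun X =>
        let ⟨C, hC⟩ := R.exists_tail X
        ⟨C, hC, k.tail (h.tail hC)⟩ }

/-- The ends of `G`: the equivalence classes of its rays. -/
def End {V : Type u} (G : SimpleGraph V) : Type u := Quotient (raySetoid G)

/-- The end containing a ray. -/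
def End.mk {V : Type u} {G : SimpleGraph V} (R : Ray G) : End G := Quotient.mk (raySetoid G) R

/-- For `X` finite and `ω` an end there is a unique component of `G - X` that contains a tail of
every ray in `ω`. -/
theorem End.existsUnique_component {V : Type u} {G : SimpleGraph V} (X : Finset V) (ω : End G) :
    ∃! C : G.ComponentCompl (X : Set V),
      ∀ R : Ray G, End.mk R = ω → ∀ᶠ n in atTop, R.vertex n ∈ C := by
  induction ω using Quotient.ind with
  | _ R =>
    obtain ⟨C, hC⟩ := R.exists_tail X
    refine ⟨C, fun S hS => Ray.Equivalent.tail (Quotient.exact hS.symm) hC, fun D hD => ?_⟩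
    obtain ⟨n, h1, h2⟩ := ((hD R rfl).and hC).exists
    exact component_eq_of_mem h1 h2

/-- `C(X, ω)`: the component of `G - X` that contains a tail of every ray in `ω`. -/
noncomputable def component {V : Type u} {G : SimpleGraph V} (X : Finset V) (ω : End G) :
    G.ComponentCompl (X : Set V) :=
  (End.existsUnique_component X ω).choose

/-! ### The graph as a one-dimensional complex -/

/-- The points of `G` viewed as a 1-complex: the vertex `v` is the basis vector of `v` in the free
real vector space on the vertices, and every edge is the straight segment between its two
endvertices. -/
structure Point {V : Type u} (G : SimpleGraph V) where
  coord : V →₀ ℝ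
  mem : (∃ v, coord = Finsupp.single v 1) ∨
    ∃ d : G.Dart, coord ∈ segment ℝ (Finsupp.single d.fst (1 : ℝ)) (Finsupp.single d.snd 1)

/-- A vertex as a point of the 1-complex. -/
noncomputable def vertexPoint {V : Type u} (G : SimpleGraph V) (v : V) : Point G :=
  ⟨Finsupp.single v 1, Or.inl ⟨v, rfl⟩⟩

/-- The characteristic map of an oriented edge `d`: the point of that edge at distance `t` from
`d.fst`, and hence at distance `1 - t` from `d.snd`. -/
noncomputable def edgePoint {V : Type u} {G : SimpleGraph V} (d : G.Dart) (t : unitInterval) :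
    Point G :=
  ⟨AffineMap.lineMap (Finsupp.single d.fst (1 : ℝ)) (Finsupp.single d.snd 1) (t : ℝ),
    Or.inr ⟨d, by
      rw [segment_eq_image_lineMap]
      exact Set.mem_image_of_mem _ t.2⟩⟩

/-- The 1-complex (weak) topology: a set is open if and only if its trace on every edge is open
in that edge, where edges are copies of `[0, 1]`. -/
@[reducible] noncomputable def complexTopology {V : Type u} (G : SimpleGraph V) : TopologicalSpace (Point G) :=
  ⨆ d : G.Dart, TopologicalSpace.coinduced (edgePoint d) inferInstance

/-- `PathOfLength x y ℓ`: there is a path from `x` to `y` in `G` of length `ℓ` that consists of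
finitely many segments, each of which is contained in an edge; every edge has length `1`. -/
inductive PathOfLength {V : Type u} {G : SimpleGraph V} : Point G → Point G → ℝ≥0 → Prop
  | refl (x : Point G) : PathOfLength x x 0
  | step (x : Point G) (d : G.Dart) (s t : unitInterval) (l : ℝ≥0) :
      PathOfLength x (edgePoint d s) l → PathOfLength x (edgePoint d t) (l + nndist s t)

theorem PathOfLength.trans {V : Type u} {G : SimpleGraph V} {x y z : Point G} {k l : ℝ≥0}
    (h : PathOfLength x y k) (h' : PathOfLength y z l) : PathOfLength x z (k + l) := by
  induction h' with
  | refl => simpa using h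
  | step d s t l _ ih => rw [← add_assoc]; exact .step _ _ _ _ _ ih

theorem PathOfLength.symm {V : Type u} {G : SimpleGraph V} {x y : Point G} {l : ℝ≥0}
    (h : PathOfLength x y l) : PathOfLength y x l := by
  induction h with
  | refl => exact .refl _
  | step d s t l _ ih =>
    have h1 := PathOfLength.step _ d t s 0 (.refl (edgePoint d t))
    rw [zero_add] at h1
    rw [add_comm, nndist_comm]
    exact h1.trans ih

/-- The length distance: the infimum of the lengths of the paths joining two points
(and `∞` if there are none). -/
noncomputable def lengthDist {V : Type u} {G : SimpleGraph V} (x y : Point G) : ℝ≥0∞ :=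
  ⨅ (l : ℝ≥0) (_ : PathOfLength x y l), (l : ℝ≥0∞)

/-- `G` as a metric length space. -/
@[reducible] noncomputable def lengthMetric {V : Type u} (G : SimpleGraph V) :
    PseudoEMetricSpace (Point G) where
  edist := lengthDist
  edist_self x := le_antisymm (iInf₂_le_of_le 0 (.refl x) (by simp)) bot_le
  edist_comm x y := by
    unfold lengthDist
    exact iInf_congr fun l => iInf_congr_Prop ⟨PathOfLength.symm, PathOfLength.symm⟩ fun _ => rfl
  edist_triangle x y z := by
    unfold lengthDist
    simp only [ENNReal.iInf_add, ENNReal.add_iInf]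
    refine le_iInf fun k => le_iInf fun h => le_iInf fun l => le_iInf fun h' => ?_
    exact iInf₂_le_of_le _ (h'.trans h) (by simp [add_comm])

/-- The topology of `G` as a metric length space. -/
@[reducible] noncomputable def lengthTopology {V : Type u} (G : SimpleGraph V) : TopologicalSpace (Point G) :=
  (lengthMetric G).toUniformSpace.toTopologicalSpace

/-! ### The space `|G|` -/

/-- The set `|G| = G ∪ Ω(G)`: the points of `G` together with the ends of `G`. -/
inductive WithEnds {V : Type u} (G : SimpleGraph V) : Type u
  | point (x : Point G)
  | ofEnd (ω : End G)

/-- The points of the 1-complex that lie in the subgraph `C(X, ω)`: its vertices and all points on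
edges with both endvertices in it. -/
def componentPoints {V : Type u} {G : SimpleGraph V} (X : Finset V) (ω : End G) :
    Set (Point G) :=
  {x | ∀ v ∈ x.coord.support, v ∈ component X ω}

/-- `Ω(X, ω)`: the ends `η` with `C(X, η) = C(X, ω)`. -/
def endsIn {V : Type u} {G : SimpleGraph V} (X : Finset V) (ω : End G) : Set (End G) :=
  {η | component X η = component X ω}

/-- A union of half-open intervals of the edges between `X` and `C(X, ω)`: for every such edge `d`,
oriented from `C(X, ω)` to `X`, the interval of the points at distance less than `r d` from its
endvertex in `C(X, ω)`. -/
def halfEdges {V : Type u} {G : SimpleGraph V} (X : Finset V) (ω : End G) (r : G.Dart → ℝ) :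
    Set (Point G) :=
  {x | ∃ d : G.Dart, d.fst ∈ component X ω ∧ d.snd ∈ X ∧
    ∃ t : unitInterval, (t : ℝ) < r d ∧ x = edgePoint d t}

/-- The open ball of radius `ε` around `C(X, ω)` in `G`, in the length metric. -/
def ballAround {V : Type u} {G : SimpleGraph V} (X : Finset V) (ω : End G) (ε : ℝ) :
    Set (Point G) :=
  {x | ∃ y ∈ componentPoints X ω, lengthDist x y < ENNReal.ofReal ε}

/-- The basic neighbourhoods of ends in Top. -/
def nhdTop {V : Type u} {G : SimpleGraph V} (X : Finset V) (ω : End G) (r : G.Dart → ℝ) :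
    Set (WithEnds G) :=
  WithEnds.point '' componentPoints X ω ∪ WithEnds.ofEnd '' endsIn X ω ∪
    WithEnds.point '' halfEdges X ω r

/-- The basic neighbourhoods of ends in MTop. -/
def nhdMTop {V : Type u} {G : SimpleGraph V} (X : Finset V) (ω : End G) (ε : ℝ) :
    Set (WithEnds G) :=
  WithEnds.point '' componentPoints X ω ∪ WithEnds.ofEnd '' endsIn X ω ∪
    WithEnds.point '' ballAround X ω ε

/-- The topology Top on `|G|`. -/
@[reducible] def spaceTop {V : Type u} (G : SimpleGraph V) : TopologicalSpace (WithEnds G) :=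
  TopologicalSpace.generateFrom
    ({W | ∃ U : Set (Point G), @IsOpen _ (complexTopology G) U ∧ W = WithEnds.point '' U} ∪
     {W | ∃ (X : Finset V) (ω : End G) (r : G.Dart → ℝ),
        (∀ d, 0 < r d ∧ r d ≤ 1) ∧ W = nhdTop X ω r})

/-- The topology MTop on `|G|`. -/
@[reducible] def spaceMTop {V : Type u} (G : SimpleGraph V) : TopologicalSpace (WithEnds G) :=
  TopologicalSpace.generateFrom
    ({W | ∃ U : Set (Point G), @IsOpen _ (lengthTopology G) U ∧ W = WithEnds.point '' U} ∪
     {W | ∃ (X : Finset V) (ω : End G) (ε : ℝ), 0 < ε ∧ W = nhdMTop X ω ε})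

end GraphEnds

/-!
Both topologies are treated together, by means of a partition of the vertex set that is adapted to
a given open cover of `|G|`.

The combinatorial core is `solvable_univ`: if every end `ω` is assigned a finite set `X ω`, then
there are pairwise disjoint vertex sets with finite neighbourhoods, each contained in one of the
components `C(X ω, ω)`, such that every end lives in one of them. Call a connected vertex set with
finite neighbourhood bad if its own ends cannot be captured in this way. If `E` is bad and `F` is a
finite subset of it, then some component of `E - F` is bad. Iterating this gives a decreasing
sequence of bad sets `Eₙ` with finite connected sets `Fₙ ⊆ Eₙ`, where `Eₙ₊₁` is a component of
`Eₙ - Fₙ` and `Fₙ` sends an edge to `Fₙ₊₁` (`BadChain`). The union of the `Fₙ` carries a ray, and since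
the finite set `X ω` of its end `ω` meets only finitely many `Fₙ`, the others that come after these
lie in `C(X ω, ω)`.

* If every bad set contained a finite set that lies in no `C(X ω, ω)`, then the `Fₙ` could be
  chosen to contain such sets, a contradiction. So some bad set `E` has all its finite subsets
  contained in sets `C(X ω, ω)` (`Bad.exists_finitely_absorbed`).
* Start in this `E`, and let `Fₙ ⊆ C(X ωₙ, ωₙ)`. Choose `Fₙ₊₁` to contain `X ωₙ ∩ Eₙ₊₁`. Then
  `Eₙ₊₂` avoids `X ωₙ`, and it has no edge to `Fₙ`, as otherwise it would lie in `C(X ωₙ, ωₙ)` and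
  not be bad. As `E` is connected, the `Eₙ` therefore have empty intersection. So some `Eₙ` avoids
  the set `X ω` of the limit end `ω`, lies in `C(X ω, ω)`, and is not bad, a contradiction
  (`not_bad`).

For the topological part, `thick p r` is the neighbourhood of a vertex set `p` in `|G|` that is
made up of the subgraph induced by `p`, the ends living in `p`, and an initial segment of length
`r d` of each edge `d` that leaves `p`. In Top the radii `r` are arbitrary, in MTop they are constant,
and `IsEndTopology` collects the common properties of the two topologies. Given an open cover, let
`C(X ω, ω)` be the vertex set of a basic neighbourhood of `ω` inside an element of the cover, and
apply `solvable_univ`. The resulting sets together with the remaining single vertices partition the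
vertices. Their neighbourhoods are pairwise disjoint for radii at most `1 / 2` and contain all
vertices and ends. What remains are compact segments of edges between different parts, each of
which is covered by finitely many elements of the cover (`IsEndTopology.paracompactSpace`). The
Hausdorff property holds because the coordinates of the points of `G`, extended by `0` to the ends,
are continuous and separate all pairs of points except pairs of ends, which have disjoint basic
neighbourhoods.
-/

namespace GraphEnds

open scoped Topology

/-! ### Connected vertex sets -/

/-- `u` and `v` are joined by a walk of `G` all of whose vertices lie in `S`. -/
def Linked {V : Type u} (G : SimpleGraph V) (S : Set V) (u v : V) : Prop :=
  ∃ p : G.Walk u v, ∀ x ∈ p.support, x ∈ S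

namespace Linked

variable {V : Type u} {G : SimpleGraph V} {S T : Set V} {u v w : V}

theorem refl (h : u ∈ S) : Linked G S u u := ⟨.nil, by simpa using h⟩

theorem symm : Linked G S u v → Linked G S v u :=
  fun ⟨p, hp⟩ => ⟨p.reverse, by simpa using hp⟩

theorem trans : Linked G S u v → Linked G S v w → Linked G S u w := by
  rintro ⟨p, hp⟩ ⟨q, hq⟩
  refine ⟨p.append q, fun x hx => ?_⟩
  rcases (SimpleGraph.Walk.mem_support_append_iff _ _).1 hx with h | h
  exacts [hp x h, hq x h]

theorem of_adj (h : G.Adj u v) (hu : u ∈ S) (hv : v ∈ S) : Linked G S u v :=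
  ⟨h.toWalk, by simp [hu, hv]⟩

theorem mono (hST : S ⊆ T) : Linked G S u v → Linked G T u v :=
  fun ⟨p, hp⟩ => ⟨p, fun x hx => hST (hp x hx)⟩

theorem right_mem : Linked G S u v → v ∈ S := fun ⟨p, hp⟩ => hp _ p.end_mem_support

/-- A walk in `S` that leaves `T` does so along an edge. -/
theorem exists_boundary (h : Linked G S u v) (hu : u ∈ T) (hv : v ∉ T) :
    ∃ a ∈ T, ∃ b ∈ S, b ∉ T ∧ G.Adj a b := by
  obtain ⟨p, hp⟩ := h
  obtain ⟨d, hd, h1, h2⟩ := p.exists_boundary_dart T hu hv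
  exact ⟨d.fst, h1, d.snd, hp _ (p.dart_snd_mem_support_of_mem_darts hd), h2, d.adj⟩

end Linked

/-- The vertex set `S` induces a connected (possibly empty) subgraph. -/
def IsLinked {V : Type u} (G : SimpleGraph V) (S : Set V) : Prop :=
  ∀ u ∈ S, ∀ v ∈ S, Linked G S u v

/-- The vertices of the component of `G[S]` that contains `u`. -/
def linkClass {V : Type u} (G : SimpleGraph V) (S : Set V) (u : V) : Set V :=
  {w | Linked G S u w}

/-- The neighbourhood of a vertex set `p`: the vertices outside `p` with a neighbour in `p`. -/
def boundary {V : Type u} (G : SimpleGraph V) (p : Set V) : Set V :=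
  {v | v ∉ p ∧ ∃ u ∈ p, G.Adj u v}

section

variable {V : Type u} {G : SimpleGraph V}

theorem linkClass_subset (S : Set V) (u : V) : linkClass G S u ⊆ S := fun _ h => h.right_mem

theorem mem_linkClass_of_adj {S : Set V} {u a b : V} (ha : a ∈ linkClass G S u) (hb : b ∈ S)
    (h : G.Adj a b) : b ∈ linkClass G S u :=
  Linked.trans ha (.of_adj h (Linked.right_mem ha) hb)

theorem isLinked_linkClass (S : Set V) (u : V) : IsLinked G (linkClass G S u) := by
  classical
  have key : ∀ v ∈ linkClass G S u, Linked G (linkClass G S u) u v := by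
    rintro v ⟨p, hp⟩
    exact ⟨p, fun x hx => ⟨p.takeUntil x hx, fun y hy =>
      hp y (p.support_takeUntil_subset_support hx hy)⟩⟩
  exact fun v hv w hw => (key v hv).symm.trans (key w hw)

theorem linkClass_eq_of_mem {S : Set V} {u v w : V} (hu : w ∈ linkClass G S u)
    (hv : w ∈ linkClass G S v) : linkClass G S u = linkClass G S v := by
  have h : Linked G S u v := Linked.trans hu (Linked.symm hv)
  ext x
  exact ⟨fun hx => h.symm.trans hx, fun hx => h.trans hx⟩

theorem boundary_linkClass_subset (S : Set V) (u : V) :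
    boundary G (linkClass G S u) ⊆ boundary G S := by
  rintro v ⟨hv, a, ha, hav⟩
  exact ⟨fun hS => hv (mem_linkClass_of_adj ha hS hav), a, linkClass_subset S u ha, hav⟩

theorem boundary_diff_subset (E F : Set V) : boundary G (E \ F) ⊆ boundary G E ∪ F := by
  rintro v ⟨hv, a, ha, hav⟩
  by_cases hF : v ∈ F
  · exact Or.inr hF
  · exact Or.inl ⟨fun hE => hv ⟨hE, hF⟩, a, ha.1, hav⟩

/-- In a connected set every finite subset is contained in a finite connected subset. -/
theorem IsLinked.exists_finset {E : Set V} (hE : IsLinked G E) {a : V} (ha : a ∈ E)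
    (A : Finset V) (hA : ↑A ⊆ E) :
    ∃ F : Finset V, a ∈ F ∧ A ⊆ F ∧ ↑F ⊆ E ∧ IsLinked G (F : Set V) := by
  classical
  choose p hp using fun x : A => hE a ha x (hA x.2)
  refine ⟨insert a (A.attach.biUnion fun x => (p x).support.toFinset), by simp, fun x hx => ?_,
    fun x hx => ?_, ?_⟩
  · refine Finset.mem_insert_of_mem (Finset.mem_biUnion.2 ⟨⟨x, hx⟩, by simp, by simp⟩)
  · rcases Finset.mem_insert.1 hx with rfl | hx
    · exact ha
    · obtain ⟨y, -, hy⟩ := Finset.mem_biUnion.1 hx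
      exact hp y x (by simpa using hy)
  · set F : Finset V := insert a (A.attach.biUnion fun x => (p x).support.toFinset) with hF
    have key : ∀ v ∈ (F : Set V), Linked G (F : Set V) a v := by
      intro v hv
      rcases Finset.mem_insert.1 hv with rfl | hv'
      · exact .refl hv
      · obtain ⟨y, -, hy⟩ := Finset.mem_biUnion.1 hv'
        have hy' : v ∈ (p y).support := by simpa using hy
        refine ⟨(p y).takeUntil v hy', fun x hx => ?_⟩
        exact Finset.mem_insert_of_mem (Finset.mem_biUnion.2
          ⟨y, by simp, List.mem_toFinset.2 ((p y).support_takeUntil_subset_support hy' hx)⟩)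
    exact fun v hv w hw => (key v hv).symm.trans (key w hw)

/-! ### Rays and components -/

theorem eventually_mem_component (R : Ray G) (X : Finset V) :
    ∀ᶠ n in atTop, R.vertex n ∈ component X (End.mk R) :=
  (End.existsUnique_component X (End.mk R)).choose_spec.1 R rfl

theorem component_eq_of_frequently {R : Ray G} {X : Finset V} {C : G.ComponentCompl (X : Set V)}
    (h : ∃ᶠ n in atTop, R.vertex n ∈ C) : component X (End.mk R) = C := by
  obtain ⟨n, h1, h2⟩ := (h.and_eventually (eventually_mem_component R X)).exists
  exact component_eq_of_mem h2 h1

/-- A connected set that avoids `X` and meets a component of `G - X` is contained in it. -/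
theorem IsLinked.mem_componentCompl {S X : Set V} (hS : IsLinked G S) (hX : Disjoint S X)
    {C : G.ComponentCompl X} {a : V} (ha : a ∈ S) (haC : a ∈ C) {v : V} (hv : v ∈ S) : v ∈ C := by
  obtain ⟨p, hp⟩ := hS v hv a ha
  have hX' : ∀ x ∈ S, x ∉ X := fun x hx => Set.disjoint_left.1 hX hx
  obtain ⟨h, rfl⟩ := haC
  exact ⟨hX' v hv, componentComplMk_eq_of_walk p (fun x hx => hX' x (hp x hx)) _ _⟩

/-- An infinite sequence of pairwise disjoint finite connected sets, each joined to the next by an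
edge, carries a ray. -/
theorem exists_ray_of_chain (F : ℕ → Finset V) (hF : ∀ n, IsLinked G (F n : Set V))
    (hd : ∀ m n, m < n → Disjoint (F m) (F n))
    (hadj : ∀ n, ∃ a ∈ F n, ∃ b ∈ F (n + 1), G.Adj a b) :
    ∃ R : Ray G, ∀ n, R.vertex n ∈ ⋃ j, (F j : Set V) := by
  classical
  choose a ha b hb hab using hadj
  -- A state consists of the current vertex and the set of vertices that may still be visited: the
  -- rest of a path to the exit of the current set, and all later sets.
  let Q : V × Set V → Prop := fun s => ∃ i, ∃ p : G.Walk s.1 (a i), p.IsPath ∧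
    (∀ x ∈ p.support, x ∈ F i) ∧ s.2 = {x | x ∈ p.support} ∪ ⋃ j, ⋃ _ : i < j, (F j : Set V)
  have hstep : ∀ s : {s // Q s}, ∃ t : {s // Q s}, G.Adj s.1.1 t.1.1 ∧ t.1.2 ⊆ s.1.2 \ {s.1.1} := by
    rintro ⟨⟨v, A⟩, i, p, hp, hpF, hA⟩
    simp only at p hp hpF hA
    subst hA
    cases p with
    | nil =>
      obtain ⟨q, hq⟩ := hF (i + 1) (b i) (hb i) (a (i + 1)) (ha (i + 1))
      refine ⟨⟨(b i, {x | x ∈ q.toPath.1.support} ∪ ⋃ j, ⋃ _ : i + 1 < j, (F j : Set V)),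
        i + 1, q.toPath.1, q.toPath.2, fun x hx => hq x (q.support_bypass_subset_support hx), rfl⟩,
        hab i, ?_⟩
      have hsub : {x | x ∈ q.toPath.1.support} ∪ ⋃ j, ⋃ _ : i + 1 < j, (F j : Set V) ⊆
          ⋃ j, ⋃ _ : i < j, (F j : Set V) := by
        intro x hx
        simp only [Set.mem_iUnion]
        rcases hx with hx | hx
        · exact ⟨i + 1, by omega, hq x (q.support_bypass_subset_support hx)⟩
        · simp only [Set.mem_iUnion] at hx
          obtain ⟨j, hj, hx⟩ := hx
          exact ⟨j, by omega, hx⟩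
      intro x hx
      have hx' := hsub hx
      refine ⟨Or.inr hx', ?_⟩
      rintro rfl
      simp only [Set.mem_iUnion] at hx'
      obtain ⟨j, hj, hx'⟩ := hx'
      exact Finset.disjoint_left.1 (hd i j hj) (ha i) hx'
    | @cons _ w _ h q =>
      rw [SimpleGraph.Walk.cons_isPath_iff] at hp
      refine ⟨⟨(w, {x | x ∈ q.support} ∪ ⋃ j, ⋃ _ : i < j, (F j : Set V)), i, q, hp.1,
        fun x hx => hpF x (List.mem_cons_of_mem _ hx), rfl⟩, h, ?_⟩
      rintro x (hx | hx)
      · refine ⟨Or.inl (List.mem_cons_of_mem _ hx), ?_⟩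
        rintro rfl
        exact hp.2 hx
      · refine ⟨Or.inr hx, ?_⟩
        rintro rfl
        simp only [Set.mem_iUnion] at hx
        obtain ⟨j, hj, hx⟩ := hx
        exact Finset.disjoint_left.1 (hd i j hj) (hpF _ (SimpleGraph.Walk.start_mem_support _)) hx
  choose f hf1 hf2 using hstep
  obtain ⟨s0⟩ : Nonempty {s // Q s} :=
    ⟨⟨(a 0, {x | x ∈ (SimpleGraph.Walk.nil (G := G) (u := a 0)).support} ∪
      ⋃ j, ⋃ _ : 0 < j, (F j : Set V)), 0, .nil, by simp, by simpa using ha 0, rfl⟩⟩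
  let s : ℕ → {s // Q s} := fun n => f^[n] s0
  have hs : ∀ n, s (n + 1) = f (s n) := fun n => Function.iterate_succ_apply' f n s0
  have hmem : ∀ n, (s n).1.1 ∈ (s n).1.2 := by
    intro n
    obtain ⟨i, p, -, -, hA⟩ := (s n).2
    rw [hA]
    exact Or.inl p.start_mem_support
  have hanti : Antitone fun n => (s n).1.2 := antitone_nat_of_succ_le fun n => by
    rw [hs]
    exact (hf2 (s n)).trans Set.sdiff_subset
  have hne : ∀ m n, m < n → (s m).1.1 ≠ (s n).1.1 := by
    intro m n hmn h
    have h1 := hanti (Nat.succ_le_of_lt hmn) (hmem n)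
    simp only [Nat.succ_eq_add_one, hs] at h1
    exact (hf2 (s m) h1).2 h.symm
  refine ⟨⟨fun n => (s n).1.1, fun m n h => ?_, fun n => ?_⟩, fun n => ?_⟩
  · rcases lt_trichotomy m n with h' | h' | h'
    · exact (hne m n h' h).elim
    · exact h'
    · exact (hne n m h' h.symm).elim
  · simp only [hs]
    exact hf1 (s n)
  · obtain ⟨i, p, -, hpF, -⟩ := (s n).2
    exact Set.mem_iUnion.2 ⟨i, hpF _ p.start_mem_support⟩

end

/-! ### Disjoint refinements of covers of the end space -/

section

variable {V : Type u} {G : SimpleGraph V}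

/-- `p` is contained in one of the components `C(X ω, ω)`. -/
def Absorbed (X : End G → Finset V) (p : Set V) : Prop :=
  ∃ ω, ∀ v ∈ p, v ∈ component (X ω) ω

/-- All ends living in `E` can be captured by pairwise disjoint subsets of `E` with finite
neighbourhoods, each of which is contained in some `C(X ω, ω)`. -/
def Solvable (X : End G → Finset V) (E : Set V) : Prop :=
  ∃ P : Set (Set V), P.PairwiseDisjoint id ∧
    (∀ p ∈ P, (boundary G p).Finite ∧ Absorbed X p ∧ p ⊆ E) ∧
    ∀ R : Ray G, (∀ᶠ n in atTop, R.vertex n ∈ E) → ∃ p ∈ P, ∀ᶠ n in atTop, R.vertex n ∈ p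

/-- A connected set with finite neighbourhood whose ends cannot be captured. -/
structure Bad (X : End G → Finset V) (E : Set V) : Prop where
  isLinked : IsLinked G E
  finite : (boundary G E).Finite
  not_solvable : ¬ Solvable X E

variable {X : End G → Finset V}

theorem Absorbed.solvable {p : Set V} (h : Absorbed X p) (hp : (boundary G p).Finite) :
    Solvable X p :=
  ⟨{p}, Set.pairwiseDisjoint_singleton _ _, by simp [h, hp], fun _ hR => ⟨p, rfl, hR⟩⟩

/-- If every component of `G[S]` is solvable, then so is `S`. -/
theorem solvable_of_linkClass {S : Set V} (h : ∀ u ∈ S, Solvable X (linkClass G S u)) :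
    Solvable X S := by
  have h' : ∀ K ∈ linkClass G S '' S, Solvable X K := by
    rintro _ ⟨u, hu, rfl⟩
    exact h u hu
  choose! P hP1 hP2 hP3 using h'
  refine ⟨⋃ K ∈ linkClass G S '' S, P K, ?_, ?_, fun R hR => ?_⟩
  · intro p hp q hq hpq
    simp only [Set.mem_iUnion, exists_prop] at hp hq
    obtain ⟨K, hK, hp⟩ := hp
    obtain ⟨L, hL, hq⟩ := hq
    by_cases hKL : K = L
    · subst hKL
      exact hP1 K hK hp hq hpq
    · refine Set.disjoint_left.2 fun x hx hx' => hKL ?_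
      have h1 := (hP2 K hK p hp).2.2 hx
      have h2 := (hP2 L hL q hq).2.2 hx'
      obtain ⟨u, -, rfl⟩ := hK
      obtain ⟨v, -, rfl⟩ := hL
      exact linkClass_eq_of_mem h1 h2
  · intro p hp
    simp only [Set.mem_iUnion, exists_prop] at hp
    obtain ⟨K, hK, hp⟩ := hp
    obtain ⟨h1, h2, h3⟩ := hP2 K hK p hp
    refine ⟨h1, h2, ?_⟩
    obtain ⟨u, -, rfl⟩ := hK
    exact h3.trans (linkClass_subset S u)
  · obtain ⟨N, hN⟩ := eventually_atTop.1 hR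
    have hK : linkClass G S (R.vertex N) ∈ linkClass G S '' S := ⟨_, hN N le_rfl, rfl⟩
    obtain ⟨p, hp, hRp⟩ := hP3 _ hK R (eventually_atTop.2 ⟨N, fun n hn => by
      induction n, hn using Nat.le_induction with
      | base => exact .refl (hN N le_rfl)
      | succ n hn ih => exact mem_linkClass_of_adj ih (hN _ (by omega)) (R.adj n)⟩)
    exact ⟨p, Set.mem_biUnion hK hp, hRp⟩

theorem Solvable.of_diff {E : Set V} {F : Finset V} (h : Solvable X (E \ F)) : Solvable X E := by
  obtain ⟨P, h1, h2, h3⟩ := h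
  refine ⟨P, h1, fun p hp => ⟨(h2 p hp).1, (h2 p hp).2.1, (h2 p hp).2.2.trans Set.sdiff_subset⟩,
    fun R hR => h3 R ?_⟩
  filter_upwards [hR, R.eventually_notMem F] with n h h' using ⟨h, h'⟩

theorem Bad.nonempty {E : Set V} (h : Bad X E) : E.Nonempty := by
  by_contra hE
  rw [Set.not_nonempty_iff_eq_empty] at hE
  subst hE
  exact h.not_solvable ⟨∅, by simp, by simp, fun R hR => by simpa using hR.exists⟩

/-- A set with finite neighbourhood that is not solvable has a bad component. -/
theorem exists_bad_linkClass {S : Set V} (hS : (boundary G S).Finite) (h : ¬ Solvable X S) :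
    ∃ u ∈ S, Bad X (linkClass G S u) := by
  by_contra! hcon
  exact h (solvable_of_linkClass fun u hu => by_contra fun h' => hcon u hu
    ⟨isLinked_linkClass S u, hS.subset (boundary_linkClass_subset S u), h'⟩)

/-- Removing finitely many vertices from a bad set leaves a bad component. -/
theorem Bad.exists_sub {E : Set V} (hE : Bad X E) (F : Finset V) :
    ∃ E', Bad X E' ∧ E' ⊆ E \ F ∧ ∀ a ∈ E', ∀ b ∈ E, G.Adj a b → b ∈ E' ∨ b ∈ F := by
  obtain ⟨u, -, hB⟩ := exists_bad_linkClass
    ((hE.finite.union F.finite_toSet).subset (boundary_diff_subset E F))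
    fun h => hE.not_solvable h.of_diff
  refine ⟨_, hB, linkClass_subset _ _, fun a ha b hb hab => ?_⟩
  by_cases hF : b ∈ F
  · exact Or.inr hF
  · exact Or.inl (mem_linkClass_of_adj ha ⟨hb, hF⟩ hab)

/-- A decreasing sequence of bad sets `set n` together with finite connected sets `core n`: the set
`set (n + 1)` is a component of `set n` minus `core n`, the sets `core n` and `core (n + 1)` are
joined by an edge, and `core (n + 1)` contains `Φ (set (n + 1)) (core n)` as far as possible. -/
structure BadChain (X : End G → Finset V) (Φ : Set V → Finset V → Finset V) where
  set : ℕ → Set V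
  core : ℕ → Finset V
  bad : ∀ n, Bad X (set n)
  core_subset : ∀ n, ↑(core n) ⊆ set n
  core_isLinked : ∀ n, IsLinked G (core n : Set V)
  core_nonempty : (core 0).Nonempty
  set_succ : ∀ n, set (n + 1) ⊆ set n \ core n
  mem_of_adj : ∀ n, ∀ a ∈ set (n + 1), ∀ b ∈ set n, G.Adj a b → b ∈ set (n + 1) ∨ b ∈ core n
  exists_adj : ∀ n, ∃ a ∈ core n, ∃ b ∈ core (n + 1), G.Adj a b
  mem_core : ∀ n, ∀ v ∈ Φ (set (n + 1)) (core n), v ∈ set (n + 1) → v ∈ core (n + 1)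

theorem Bad.exists_chain {E : Set V} (hE : Bad X E) (Φ : Set V → Finset V → Finset V) :
    ∃ c : BadChain X Φ, c.set 0 = E := by
  classical
  let Q : Set V × Finset V → Prop := fun s =>
    Bad X s.1 ∧ ↑s.2 ⊆ s.1 ∧ IsLinked G (s.2 : Set V) ∧ s.2.Nonempty
  have hstep : ∀ s : {s // Q s}, ∃ t : {s // Q s}, t.1.1 ⊆ s.1.1 \ s.1.2 ∧
      (∀ a ∈ t.1.1, ∀ b ∈ s.1.1, G.Adj a b → b ∈ t.1.1 ∨ b ∈ s.1.2) ∧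
      (∃ a ∈ s.1.2, ∃ b ∈ t.1.2, G.Adj a b) ∧
      ∀ v ∈ Φ t.1.1 s.1.2, v ∈ t.1.1 → v ∈ t.1.2 := by
    rintro ⟨⟨E, F⟩, hE, hFE, hF, f, hf⟩
    simp only at hE hFE hF hf
    obtain ⟨E', hE', hsub, hadj⟩ := hE.exists_sub F
    obtain ⟨e, he⟩ := hE'.nonempty
    obtain ⟨a, ha, b, hb, hbE', hab⟩ := (hE.isLinked e (hsub he).1 f (hFE hf)).exists_boundary
      he (fun h => (hsub h).2 hf)
    have hbF := (hadj a ha b hb hab).resolve_left hbE'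
    obtain ⟨F', haF', hsubF', hF'E', hF'⟩ := hE'.isLinked.exists_finset ha
      ((Φ E' F).filter (· ∈ E')) fun x hx => (Finset.mem_filter.1 hx).2
    exact ⟨⟨(E', F'), hE', hF'E', hF', a, haF'⟩, hsub, hadj, ⟨b, hbF, a, haF', hab.symm⟩,
      fun v hv hvE => hsubF' (Finset.mem_filter.2 ⟨hv, hvE⟩)⟩
  choose f hf1 hf2 hf3 hf4 using hstep
  obtain ⟨e, he⟩ := hE.nonempty
  let s0 : {s // Q s} := ⟨(E, {e}), hE, by simpa using he, by
    simpa [IsLinked] using Linked.refl (G := G) (Set.mem_singleton e), by simp⟩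
  let s : ℕ → {s // Q s} := fun n => f^[n] s0
  have hs : ∀ n, s (n + 1) = f (s n) := fun n => Function.iterate_succ_apply' f n s0
  exact ⟨{
    set := fun n => (s n).1.1
    core := fun n => (s n).1.2
    bad := fun n => (s n).2.1
    core_subset := fun n => (s n).2.2.1
    core_isLinked := fun n => (s n).2.2.2.1
    core_nonempty := (s 0).2.2.2.2
    set_succ := fun n => by simp only [hs]; exact hf1 (s n)
    mem_of_adj := fun n => by simp only [hs]; exact hf2 (s n)
    exists_adj := fun n => by simp only [hs]; exact hf3 (s n)
    mem_core := fun n => by simp only [hs]; exact hf4 (s n) }, rfl⟩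

namespace BadChain

variable {Φ : Set V → Finset V → Finset V} (c : BadChain X Φ)

theorem antitone : Antitone c.set :=
  antitone_nat_of_succ_le fun n => (c.set_succ n).trans Set.sdiff_subset

theorem notMem_core {m n : ℕ} (h : m < n) {v : V} (hv : v ∈ c.set n) : v ∉ c.core m :=
  (c.set_succ m (c.antitone (Nat.succ_le_of_lt h) hv)).2

theorem disjoint_core {m n : ℕ} (h : m < n) : Disjoint (c.core m) (c.core n) :=
  Finset.disjoint_left.2 fun _ hm hn => c.notMem_core h (c.core_subset n hn) hm

/-- The tails of the sequence of cores have connected unions. -/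
theorem isLinked_tail (n : ℕ) : IsLinked G (⋃ j, ⋃ _ : n ≤ j, (c.core j : Set V)) := by
  have hsub : ∀ j, n ≤ j → (c.core j : Set V) ⊆ ⋃ j, ⋃ _ : n ≤ j, (c.core j : Set V) :=
    fun j hj x hx => Set.mem_iUnion₂.2 ⟨j, hj, hx⟩
  obtain ⟨a, ha, -⟩ := c.exists_adj n
  have key : ∀ j, n ≤ j → ∀ v ∈ c.core j,
      Linked G (⋃ j, ⋃ _ : n ≤ j, (c.core j : Set V)) a v := by
    intro j hj
    induction j, hj using Nat.le_induction with
    | base => exact fun v hv => (c.core_isLinked n a ha v hv).mono (hsub n le_rfl)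
    | succ j hj ih =>
      intro v hv
      obtain ⟨x, hx, y, hy, hxy⟩ := c.exists_adj j
      have hj' : n ≤ j + 1 := by omega
      exact ((ih x hx).trans (.of_adj hxy (hsub j hj hx) (hsub _ hj' hy))).trans
        ((c.core_isLinked _ y hy v hv).mono (hsub _ hj'))
  intro v hv w hw
  obtain ⟨i, hi, hv⟩ := Set.mem_iUnion₂.1 hv
  obtain ⟨j, hj, hw⟩ := Set.mem_iUnion₂.1 hw
  exact (key i hi v hv).symm.trans (key j hj w hw)

/-- The cores converge to an end. -/
theorem exists_ray : ∃ R : Ray G, ∀ n,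
    ∀ᶠ k in atTop, R.vertex k ∈ ⋃ j, ⋃ _ : n ≤ j, (c.core j : Set V) := by
  classical
  obtain ⟨R, hR⟩ := exists_ray_of_chain c.core c.core_isLinked (fun _ _ => c.disjoint_core)
    c.exists_adj
  refine ⟨R, fun n => ?_⟩
  filter_upwards [R.eventually_notMem ((Finset.range n).biUnion c.core)] with k hk
  obtain ⟨j, hj⟩ := Set.mem_iUnion.1 (hR k)
  refine Set.mem_iUnion₂.2 ⟨j, ?_, hj⟩
  by_contra hlt
  exact hk (Finset.mem_biUnion.2 ⟨j, Finset.mem_range.2 (not_le.1 hlt), hj⟩)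

theorem tail_subset (n : ℕ) : (⋃ j, ⋃ _ : n ≤ j, (c.core j : Set V)) ⊆ c.set n := by
  intro v hv
  obtain ⟨j, hj, hv⟩ := Set.mem_iUnion₂.1 hv
  exact c.antitone hj (c.core_subset j hv)

/-- A finite set is avoided by all but finitely many cores. -/
theorem exists_disjoint_tail (Y : Finset V) :
    ∃ n, Disjoint (⋃ j, ⋃ _ : n ≤ j, (c.core j : Set V)) (Y : Set V) := by
  classical
  induction Y using Finset.induction_on with
  | empty => exact ⟨0, by simp⟩
  | insert y Y _ ih =>
    obtain ⟨n, hn⟩ := ih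
    have hmono : ∀ {m}, n ≤ m → (⋃ j, ⋃ _ : m ≤ j, (c.core j : Set V)) ⊆
        ⋃ j, ⋃ _ : n ≤ j, (c.core j : Set V) := fun hm x hx => by
      obtain ⟨j, hj, hx⟩ := Set.mem_iUnion₂.1 hx
      exact Set.mem_iUnion₂.2 ⟨j, hm.trans hj, hx⟩
    by_cases hy : ∃ j, y ∈ c.core j
    · obtain ⟨i, hi⟩ := hy
      refine ⟨max n (i + 1), ?_⟩
      rw [Finset.coe_insert, Set.disjoint_insert_right]
      refine ⟨fun h => ?_, hn.mono_left (hmono (le_max_left _ _))⟩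
      obtain ⟨j, hj, h⟩ := Set.mem_iUnion₂.1 h
      exact Finset.disjoint_left.1 (c.disjoint_core (m := i) (n := j)
        (lt_of_lt_of_le (Nat.lt_succ_self i) ((le_max_right _ _).trans hj))) hi h
    · refine ⟨n, ?_⟩
      rw [Finset.coe_insert, Set.disjoint_insert_right]
      refine ⟨fun h => hy ?_, hn⟩
      obtain ⟨j, -, h⟩ := Set.mem_iUnion₂.1 h
      exact ⟨j, h⟩

end BadChain

/-- A connected set that avoids `Y` and contains a tail of a ray lies in the component of `G - Y`
in which the ray has a tail. -/
theorem IsLinked.mem_component {S : Set V} (hS : IsLinked G S) {Y : Finset V}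
    (hY : Disjoint S (Y : Set V)) {R : Ray G} (hR : ∀ᶠ n in atTop, R.vertex n ∈ S) {v : V}
    (hv : v ∈ S) : v ∈ component Y (End.mk R) := by
  obtain ⟨n, h1, h2⟩ := (hR.and (eventually_mem_component R Y)).exists
  exact hS.mem_componentCompl hY h1 h2 hv

/-- If there is a bad set, then there is one all of whose finite subsets are contained in
components `C(X ω, ω)`: otherwise take a chain in which every core contains a counterexample. The
cores converge to an end `ω`, and all but finitely many of them lie in `C(X ω, ω)`. -/
theorem Bad.exists_finitely_absorbed {E : Set V} (hE : Bad X E) :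
    ∃ E', Bad X E' ∧ ∀ F : Finset V, ↑F ⊆ E' → Absorbed X (F : Set V) := by
  by_contra! hcon
  choose! Φ hΦ1 hΦ2 using hcon
  obtain ⟨c, -⟩ := hE.exists_chain fun E _ => Φ E
  obtain ⟨R, hR⟩ := c.exists_ray
  obtain ⟨n, hn⟩ := c.exists_disjoint_tail (X (End.mk R))
  refine hΦ2 _ (c.bad (n + 1)) ⟨End.mk R, fun v hv => ?_⟩
  refine (c.isLinked_tail n).mem_component hn (hR n) (Set.mem_iUnion₂.2 ⟨n + 1, by omega, ?_⟩)
  exact c.mem_core n v hv (hΦ1 _ (c.bad (n + 1)) hv)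

/-- In a chain whose sets eventually lose contact with each core, no vertex lies in all sets. -/
theorem BadChain.exists_notMem {Φ : Set V → Finset V → Finset V} (c : BadChain X Φ)
    (h : ∀ n, ∀ a ∈ c.set (n + 2), ∀ b ∈ c.core n, ¬ G.Adj a b) (v : V) : ∃ n, v ∉ c.set n := by
  classical
  by_contra! hv
  obtain ⟨f, hf⟩ := c.core_nonempty
  obtain ⟨a, ha, b, hb, hb', hab⟩ := ((c.bad 0).isLinked v (hv 0) f
    (c.core_subset 0 hf)).exists_boundary (T := ⋂ n, c.set n) (Set.mem_iInter.2 hv)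
    fun h => c.notMem_core Nat.zero_lt_one (Set.mem_iInter.1 h 1) hf
  rw [Set.mem_iInter] at ha hb'
  push Not at hb'
  -- The last set of the chain that contains `b` has `b` in its core.
  obtain ⟨n, hn⟩ : ∃ n, Nat.find hb' = n + 1 :=
    Nat.exists_eq_succ_of_ne_zero fun h0 => Nat.find_spec hb' (h0 ▸ hb)
  have h1 : b ∉ c.set (n + 1) := hn ▸ Nat.find_spec hb'
  have h2 : b ∈ c.set n := not_not.1 (Nat.find_min hb' (by omega))
  exact h n a (ha _) b ((c.mem_of_adj n a (ha _) b h2 hab).resolve_left h1) hab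

/-- There are no bad sets. Given one all of whose finite subsets lie in components `C(X ω, ω)`, take
a chain in which every core contains the finite set `X ω` that belongs to the previous core. Then
the sets of the chain lose contact with the earlier cores, so that they have empty intersection,
and all but finitely many of them are contained in `C(X ω, ω)` for the limit `ω` of the cores. -/
theorem not_bad (E : Set V) : ¬ Bad X E := by
  intro hE
  obtain ⟨E', hE', hfin⟩ := hE.exists_finitely_absorbed
  have : Nonempty (End G) := ⟨(hfin ∅ (by simp)).choose⟩
  choose! ω hω using hfin
  obtain ⟨c, hc⟩ := hE'.exists_chain fun _ F => X (ω F)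
  have habs : ∀ n, ¬ Absorbed X (c.set n) := fun n h =>
    (c.bad n).not_solvable (h.solvable (c.bad n).finite)
  have hdisj : ∀ n, ∀ a ∈ c.set (n + 2), ∀ b ∈ c.core n, ¬ G.Adj a b := by
    intro n a ha b hb hab
    have hX : Disjoint (c.set (n + 2)) (X (ω (c.core n)) : Set V) :=
      Set.disjoint_left.2 fun x hx hxX => c.notMem_core (Nat.lt_succ_self (n + 1)) hx
        (c.mem_core n x hxX (c.antitone (Nat.le_succ _) hx))
    have hb' := hω (c.core n) ((c.core_subset n).trans (hc ▸ c.antitone (Nat.zero_le n))) b hb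
    have ha' : a ∈ component (X (ω (c.core n))) (ω (c.core n)) :=
      SimpleGraph.ComponentCompl.mem_of_adj _ _ hb' (Set.disjoint_left.1 hX ha) hab.symm
    exact habs (n + 2) ⟨_, fun v hv => (c.bad (n + 2)).isLinked.mem_componentCompl hX ha ha' hv⟩
  have hempty := c.exists_notMem hdisj
  choose k hk using hempty
  obtain ⟨R, hR⟩ := c.exists_ray
  set n := (X (End.mk R)).sup k
  refine habs n ⟨End.mk R, fun v hv => (c.bad n).isLinked.mem_component ?_
    ((hR n).mono fun _ h => c.tail_subset n h) hv⟩
  exact Set.disjoint_left.2 fun x hx hxX => hk x (c.antitone (Finset.le_sup hxX) hx)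

/-- The combinatorial core: every assignment `ω ↦ C(X ω, ω)` of neighbourhoods to the ends has a
refinement by pairwise disjoint vertex sets with finite neighbourhoods in which all ends live. -/
theorem solvable_univ (X : End G → Finset V) : Solvable X Set.univ := by
  by_contra h
  obtain ⟨u, -, hB⟩ := exists_bad_linkClass (by simp [boundary]) h
  exact not_bad _ hB

end

/-! ### Points of the 1-complex -/

section

variable {V : Type u} {G : SimpleGraph V}

theorem Point.ext_coord {x y : Point G} (h : x.coord = y.coord) : x = y := by
  cases x
  cases y
  simpa using h

theorem coord_edgePoint (d : G.Dart) (t : unitInterval) :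
    (edgePoint d t).coord = Finsupp.single d.fst (1 - t : ℝ) + Finsupp.single d.snd (t : ℝ) := by
  simp only [edgePoint, AffineMap.lineMap_apply_module, Finsupp.smul_single, smul_eq_mul, mul_one]

theorem coord_edgePoint_fst (d : G.Dart) (t : unitInterval) :
    (edgePoint d t).coord d.fst = 1 - t := by
  simp [coord_edgePoint, d.adj.ne]

theorem coord_edgePoint_snd (d : G.Dart) (t : unitInterval) :
    (edgePoint d t).coord d.snd = t := by
  simp [coord_edgePoint, d.adj.ne']

theorem coord_edgePoint_of_ne {d : G.Dart} {v : V} (h1 : v ≠ d.fst) (h2 : v ≠ d.snd)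
    (t : unitInterval) : (edgePoint d t).coord v = 0 := by
  simp [coord_edgePoint, h1, h2]

theorem eq_fst_or_snd_of_coord_ne_zero {d : G.Dart} {t : unitInterval} {v : V}
    (h : (edgePoint d t).coord v ≠ 0) : v = d.fst ∨ v = d.snd := by
  by_contra! hcon
  exact h (coord_edgePoint_of_ne hcon.1 hcon.2 t)

theorem edgePoint_zero (d : G.Dart) : edgePoint d 0 = vertexPoint G d.fst :=
  Point.ext_coord (by simp [coord_edgePoint, vertexPoint])

theorem edgePoint_one (d : G.Dart) : edgePoint d 1 = vertexPoint G d.snd :=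
  Point.ext_coord (by simp [coord_edgePoint, vertexPoint])

theorem edgePoint_symm (d : G.Dart) (t : unitInterval) :
    edgePoint d.symm t = edgePoint d (unitInterval.symm t) :=
  Point.ext_coord (by simp [coord_edgePoint, add_comm])

/-- Every point is a vertex or an inner point of an edge. -/
theorem Point.eq_vertexPoint_or (x : Point G) : (∃ v, x = vertexPoint G v) ∨
    ∃ (d : G.Dart) (t : unitInterval), 0 < (t : ℝ) ∧ (t : ℝ) < 1 ∧ x = edgePoint d t := by
  obtain ⟨c, ⟨v, rfl⟩ | ⟨d, hd⟩⟩ := x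
  · exact Or.inl ⟨v, rfl⟩
  · rw [segment_eq_image_lineMap] at hd
    obtain ⟨t, ht, rfl⟩ := hd
    rcases ht.1.eq_or_lt with rfl | h0
    · exact Or.inl ⟨d.fst, Point.ext_coord (by simp [vertexPoint])⟩
    rcases ht.2.eq_or_lt with rfl | h1
    · exact Or.inl ⟨d.snd, Point.ext_coord (by simp [vertexPoint])⟩
    exact Or.inr ⟨d, ⟨t, ht⟩, h0, h1, rfl⟩

/-- The inner points of an edge determine the edge up to orientation. -/
theorem dart_eq_of_coord_pos {d e : G.Dart} {t : unitInterval}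
    (h1 : 0 < (edgePoint e t).coord d.fst) (h2 : 0 < (edgePoint e t).coord d.snd) :
    e = d ∨ e = d.symm := by
  have hd := d.adj.ne
  rcases eq_fst_or_snd_of_coord_ne_zero h1.ne' with h | h <;>
    rcases eq_fst_or_snd_of_coord_ne_zero h2.ne' with h' | h'
  · exact (hd (h.trans h'.symm)).elim
  · exact Or.inl (SimpleGraph.Dart.ext _ _ (Prod.ext h.symm h'.symm))
  · exact Or.inr (SimpleGraph.Dart.ext _ _ (Prod.ext h'.symm h.symm))
  · exact (hd (h.trans h'.symm)).elim

/-- A point with positive coordinates at both ends of `d` is an inner point of `d`. -/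
theorem eq_edgePoint_of_coord_pos {d : G.Dart} {x : Point G} (h1 : 0 < x.coord d.fst)
    (h2 : 0 < x.coord d.snd) :
    ∃ t : unitInterval, 0 < (t : ℝ) ∧ (t : ℝ) < 1 ∧ x = edgePoint d t := by
  rcases x.eq_vertexPoint_or with ⟨v, rfl⟩ | ⟨e, t, ht0, ht1, rfl⟩
  · have e1 : v = d.fst := by
      by_contra h
      simp [vertexPoint, h] at h1
    have e2 : v = d.snd := by
      by_contra h
      simp [vertexPoint, h] at h2
    exact (d.adj.ne (e1.symm.trans e2)).elim
  · rcases dart_eq_of_coord_pos h1 h2 with rfl | rfl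
    · exact ⟨t, ht0, ht1, rfl⟩
    · exact ⟨unitInterval.symm t, by simpa using ht1, by simpa using ht0, edgePoint_symm d t⟩

/-! ### Neighbourhoods of vertex sets -/

/-- The points of `G` that belong to the neighbourhood of radius `r` of the vertex set `p`: those of
the subgraph induced by `p`, and on each edge `d` that leaves `p` those at distance less than `r d`
from its endvertex in `p`. -/
def trace (p : Set V) (r : G.Dart → ℝ) : Set (Point G) :=
  {x | ∀ v ∈ x.coord.support, v ∈ p} ∪
    {x | ∃ d : G.Dart, d.fst ∈ p ∧ d.snd ∉ p ∧ ∃ t : unitInterval, (t : ℝ) < r d ∧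
      x = edgePoint d t}

/-- The end `ω` has a ray with a tail in `p`. -/
def LivesIn (p : Set V) (ω : End G) : Prop :=
  ∃ R : Ray G, End.mk R = ω ∧ ∀ᶠ n in atTop, R.vertex n ∈ p

/-- The neighbourhood of radius `r` of the vertex set `p` in `|G|`. -/
def thick (p : Set V) (r : G.Dart → ℝ) : Set (WithEnds G) :=
  WithEnds.point '' trace p r ∪ WithEnds.ofEnd '' {ω | LivesIn p ω}

@[simp] theorem point_mem_thick {p : Set V} {r : G.Dart → ℝ} {x : Point G} :
    WithEnds.point x ∈ thick p r ↔ x ∈ trace p r := by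
  simp [thick]

@[simp] theorem ofEnd_mem_thick {p : Set V} {r : G.Dart → ℝ} {ω : End G} :
    WithEnds.ofEnd ω ∈ thick p r ↔ LivesIn p ω := by
  simp [thick]

theorem vertexPoint_mem_trace {p : Set V} {r : G.Dart → ℝ} (hr : ∀ d, r d ≤ 1) {v : V} :
    vertexPoint G v ∈ trace p r ↔ v ∈ p := by
  constructor
  · rintro (h | ⟨d, hd, -, t, ht, h⟩)
    · exact h v (by simp [vertexPoint])
    · have h1 : (vertexPoint G v).coord d.fst ≠ 0 := by
        rw [h, coord_edgePoint_fst]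
        linarith [hr d]
      have h2 : v = d.fst := by
        by_contra h'
        simp [vertexPoint, h'] at h1
      exact h2 ▸ hd
  · refine fun h => Or.inl fun w hw => ?_
    have : w = v := by
      by_contra h'
      simp [vertexPoint] at hw
      exact h' hw
    exact this ▸ h

theorem edgePoint_mem_trace_of_mem {p : Set V} {r : G.Dart → ℝ} {d : G.Dart} (h1 : d.fst ∈ p)
    (h2 : d.snd ∈ p) (t : unitInterval) : edgePoint d t ∈ trace p r := by
  refine Or.inl fun v hv => ?_
  rcases eq_fst_or_snd_of_coord_ne_zero (Finsupp.mem_support_iff.1 hv) with rfl | rfl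
  exacts [h1, h2]

theorem edgePoint_mem_trace_of_lt {p : Set V} {r : G.Dart → ℝ} {d : G.Dart} (h1 : d.fst ∈ p)
    {t : unitInterval} (ht : (t : ℝ) < r d) : edgePoint d t ∈ trace p r := by
  by_cases h2 : d.snd ∈ p
  · exact edgePoint_mem_trace_of_mem h1 h2 t
  · exact Or.inr ⟨d, h1, h2, t, ht, rfl⟩

/-- The inner points of an edge that belong to a neighbourhood of a vertex set. -/
theorem edgePoint_mem_trace_iff_of_pos {p : Set V} {r : G.Dart → ℝ} {d : G.Dart} {t : unitInterval}
    (h0 : 0 < (t : ℝ)) (h1 : (t : ℝ) < 1) :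
    edgePoint d t ∈ trace p r ↔ (d.fst ∈ p ∧ d.snd ∈ p) ∨ (d.fst ∈ p ∧ (t : ℝ) < r d) ∨
      (d.snd ∈ p ∧ 1 - (t : ℝ) < r d.symm) := by
  constructor
  · rintro (h | ⟨e, he1, he2, s, hs, h⟩)
    · refine Or.inl ⟨h _ ?_, h _ ?_⟩
      · rw [Finsupp.mem_support_iff, coord_edgePoint_fst]
        linarith
      · rw [Finsupp.mem_support_iff, coord_edgePoint_snd]
        exact h0.ne'
    · have hf : 0 < (edgePoint e s).coord d.fst := by
        rw [← h, coord_edgePoint_fst]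
        linarith
      have hs' : 0 < (edgePoint e s).coord d.snd := by rwa [← h, coord_edgePoint_snd]
      rcases dart_eq_of_coord_pos hf hs' with rfl | rfl
      · have : (t : ℝ) = s := by rw [← coord_edgePoint_snd e t, h, coord_edgePoint_snd]
        exact Or.inr (Or.inl ⟨he1, this ▸ hs⟩)
      · have : (1 - t : ℝ) = s := by
          rw [← coord_edgePoint_fst d t, h, edgePoint_symm, coord_edgePoint_fst]
          simp
        exact Or.inr (Or.inr ⟨he1, this ▸ hs⟩)
  · rintro (⟨h1, h2⟩ | ⟨h1, h2⟩ | ⟨h1, h2⟩)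
    · exact edgePoint_mem_trace_of_mem h1 h2 t
    · exact edgePoint_mem_trace_of_lt h1 h2
    · have := edgePoint_mem_trace_of_lt (p := p) (r := r) (d := d.symm)
        (t := unitInterval.symm t) h1 (by simpa using h2)
      simpa [edgePoint_symm] using this

theorem edgePoint_mem_trace {p : Set V} {r : G.Dart → ℝ} (hr : ∀ d, 0 < r d ∧ r d ≤ 1)
    {d : G.Dart} {t : unitInterval} :
    edgePoint d t ∈ trace p r ↔ (d.fst ∈ p ∧ d.snd ∈ p) ∨ (d.fst ∈ p ∧ (t : ℝ) < r d) ∨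
      (d.snd ∈ p ∧ 1 - (t : ℝ) < r d.symm) := by
  rcases t.2.1.eq_or_lt with h0 | h0
  · obtain rfl : t = 0 := Subtype.ext h0.symm
    rw [edgePoint_zero, vertexPoint_mem_trace fun d => (hr d).2]
    have h1 := (hr d).1
    have h2 := (hr d.symm).2.not_gt
    simpa [h1, h2] using fun h _ => h
  rcases t.2.2.eq_or_lt with h1 | h1
  · obtain rfl : t = 1 := Subtype.ext h1
    rw [edgePoint_one, vertexPoint_mem_trace fun d => (hr d).2]
    have h1 := (hr d.symm).1
    have h2 := (hr d).2.not_gt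
    simp [h1, h2]
  · exact edgePoint_mem_trace_iff_of_pos h0 h1

theorem eq_or_eq_edgePoint_of_mem_trace_singleton {v : V} {r : G.Dart → ℝ} {x : Point G}
    (hx : x ∈ trace {v} r) : x = vertexPoint G v ∨
      ∃ (d : G.Dart) (t : unitInterval), d.fst = v ∧ (t : ℝ) < r d ∧ x = edgePoint d t := by
  rcases hx with h | ⟨d, h1, -, t, ht, rfl⟩
  · rcases x.eq_vertexPoint_or with ⟨w, rfl⟩ | ⟨d, t, h0, h1, rfl⟩
    · obtain rfl : w = v := h w (by simp [vertexPoint])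
      exact Or.inl rfl
    · have e1 : d.fst = v := h _ (by
        rw [Finsupp.mem_support_iff, coord_edgePoint_fst]; linarith)
      have e2 : d.snd = v := h _ (by
        rw [Finsupp.mem_support_iff, coord_edgePoint_snd]; exact h0.ne')
      exact (d.adj.ne (e1.trans e2.symm)).elim
  · exact Or.inr ⟨d, t, h1, ht, rfl⟩

theorem trace_mono {p q : Set V} (hpq : p ⊆ q) {r s : G.Dart → ℝ} (hrs : ∀ d, r d ≤ s d) :
    trace p r ⊆ trace q s := by
  rintro x (h | ⟨d, h1, -, t, ht, rfl⟩)
  · exact Or.inl fun v hv => hpq (h v hv)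
  · exact edgePoint_mem_trace_of_lt (hpq h1) (ht.trans_le (hrs d))

theorem thick_mono {p q : Set V} (hpq : p ⊆ q) {r s : G.Dart → ℝ} (hrs : ∀ d, r d ≤ s d) :
    thick p r ⊆ thick q s := by
  refine Set.union_subset_union (Set.image_mono (trace_mono hpq hrs)) (Set.image_mono ?_)
  rintro ω ⟨R, hR, h⟩
  exact ⟨R, hR, h.mono fun _ hn => hpq hn⟩

/-- Vertex sets that have open neighbourhoods in `|G|`: those with finite neighbourhood in `G`, and
single vertices. -/
def Tame (G : SimpleGraph V) (p : Set V) : Prop :=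
  (boundary G p).Finite ∨ p.Subsingleton

/-- A component of `G - X` that meets a set with neighbourhood in `X` is contained in it. -/
theorem componentCompl_subset {p : Set V} {X : Set V} (hp : boundary G p ⊆ X)
    {C : G.ComponentCompl X} {a : V} (ha : a ∈ p) (haC : a ∈ C) {v : V} (hv : v ∈ C) : v ∈ p := by
  obtain ⟨ha', rfl⟩ := haC
  obtain ⟨hv', h⟩ := hv
  obtain ⟨w, hw⟩ := exists_walk_of_componentComplMk_eq ha' hv' h.symm
  by_contra hvp
  obtain ⟨x, hx, y, hy, hyp, hxy⟩ :=
    Linked.exists_boundary (S := Xᶜ) (T := p) ⟨w, hw⟩ ha hvp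
  exact hy (hp ⟨hyp, x, hx, hxy⟩)

theorem not_livesIn_of_subsingleton {p : Set V} (hp : p.Subsingleton) (ω : End G) :
    ¬ LivesIn p ω := by
  rintro ⟨R, -, h⟩
  obtain ⟨N, hN⟩ := eventually_atTop.1 h
  exact absurd (R.injective (hp (hN N le_rfl) (hN (N + 1) (by omega)))) (by omega)

theorem LivesIn.component_subset {p : Set V} {ω : End G} (h : LivesIn p ω) {X : Finset V}
    (hX : boundary G p ⊆ X) {v : V} (hv : v ∈ component X ω) : v ∈ p := by
  obtain ⟨R, rfl, hR⟩ := h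
  obtain ⟨n, h1, h2⟩ := (hR.and (eventually_mem_component R X)).exists
  exact componentCompl_subset hX h1 h2 hv

theorem Tame.eventually_mem {p : Set V} (hp : Tame G p) {R : Ray G} (h : LivesIn p (End.mk R)) :
    ∀ᶠ n in atTop, R.vertex n ∈ p := by
  rcases hp with hp | hp
  · exact (eventually_mem_component R hp.toFinset).mono fun n hn =>
      h.component_subset (by simp) hn
  · exact (not_livesIn_of_subsingleton hp _ h).elim

theorem not_livesIn_of_disjoint {p q : Set V} (hp : Tame G p) (hpq : Disjoint p q) {ω : End G}
    (h : LivesIn p ω) : ¬ LivesIn q ω := by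
  rintro ⟨R, rfl, hR⟩
  obtain ⟨n, h1, h2⟩ := ((hp.eventually_mem h).and hR).exists
  exact Set.disjoint_left.1 hpq h1 h2

theorem disjoint_thick {p q : Set V} (hp : Tame G p) (hpq : Disjoint p q) {r s : G.Dart → ℝ}
    (hr : ∀ d, r d ≤ 1 / 2) (hs : ∀ d, s d ≤ 1 / 2) : Disjoint (thick p r) (thick q s) := by
  have hpq' : ∀ v, v ∈ p → v ∈ q → False := fun v hv => Set.disjoint_left.1 hpq hv
  refine Set.disjoint_left.2 fun y => ?_
  rcases y with x | ω
  · rw [point_mem_thick, point_mem_thick]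
    rcases x.eq_vertexPoint_or with ⟨v, rfl⟩ | ⟨d, t, h0, h1, rfl⟩
    · rw [vertexPoint_mem_trace fun d => (hr d).trans (by norm_num),
        vertexPoint_mem_trace fun d => (hs d).trans (by norm_num)]
      exact hpq' v
    · rw [edgePoint_mem_trace_iff_of_pos h0 h1, edgePoint_mem_trace_iff_of_pos h0 h1]
      rintro (⟨h1, h2⟩ | ⟨h1, h2⟩ | ⟨h1, h2⟩) (⟨h3, h4⟩ | ⟨h3, h4⟩ | ⟨h3, h4⟩)
      all_goals first
        | exact hpq' _ h1 h3
        | exact hpq' _ h2 h3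
        | exact hpq' _ h1 h4
        | exact hpq' _ h2 h4
        | linarith [hr d, hs d, hr d.symm, hs d.symm]
  · rw [ofEnd_mem_thick, ofEnd_mem_thick]
    exact not_livesIn_of_disjoint hp hpq

/-! ### Basic neighbourhoods of ends -/

theorem mem_endsIn_iff {X : Finset V} {ω η : End G} :
    η ∈ endsIn X ω ↔ LivesIn {v | v ∈ component X ω} η := by
  constructor
  · intro h
    induction η using Quotient.ind with
    | _ R => exact ⟨R, rfl, (show component X (End.mk R) = component X ω from h) ▸
        eventually_mem_component R X⟩
  · rintro ⟨R, rfl, hR⟩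
    exact component_eq_of_frequently hR.frequently

theorem livesIn_component (X : Finset V) (ω : End G) : LivesIn {v | v ∈ component X ω} ω :=
  mem_endsIn_iff.1 rfl

theorem mem_of_adj_of_mem_component {X : Finset V} {ω : End G} {a b : V}
    (ha : a ∈ component X ω) (hab : G.Adj a b) (hb : b ∉ component X ω) : b ∈ X := by
  by_contra h
  exact hb (SimpleGraph.ComponentCompl.mem_of_adj _ _ ha h hab)

theorem notMem_of_mem_component {X : Finset V} {ω : End G} {a : V}
    (ha : a ∈ component X ω) : a ∉ X := ha.1

theorem boundary_component_subset (X : Finset V) (ω : End G) :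
    boundary G {v | v ∈ component X ω} ⊆ X := by
  rintro v ⟨hv, a, ha, hav⟩
  exact mem_of_adj_of_mem_component ha hav hv

theorem tame_component (X : Finset V) (ω : End G) : Tame G {v | v ∈ component X ω} :=
  Or.inl (X.finite_toSet.subset (boundary_component_subset X ω))

theorem componentPoints_union_halfEdges (X : Finset V) (ω : End G) (r : G.Dart → ℝ) :
    componentPoints X ω ∪ halfEdges X ω r = trace {v | v ∈ component X ω} r := by
  refine congrArg (componentPoints X ω ∪ ·) (Set.ext fun x => ?_)
  constructor
  · rintro ⟨d, h1, h2, h⟩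
    exact ⟨d, h1, fun h3 => notMem_of_mem_component h3 h2, h⟩
  · rintro ⟨d, h1, h2, h⟩
    exact ⟨d, h1, mem_of_adj_of_mem_component h1 d.adj h2, h⟩

theorem nhdTop_eq_thick (X : Finset V) (ω : End G) (r : G.Dart → ℝ) :
    nhdTop X ω r = thick {v | v ∈ component X ω} r := by
  rw [nhdTop, thick, ← componentPoints_union_halfEdges, Set.image_union, Set.union_right_comm]
  congr 2
  ext η
  exact mem_endsIn_iff

theorem component_subset_component {X Y : Finset V} (h : X ⊆ Y) (ω : End G) :
    {v | v ∈ component Y ω} ⊆ {v | v ∈ component X ω} := fun _ hv =>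
  (livesIn_component X ω).component_subset
    ((boundary_component_subset X ω).trans (Finset.coe_subset.2 h)) hv

end

/-! ### Separation and paracompactness -/

section

variable {V : Type u} {G : SimpleGraph V}

/-- The coordinate of a point of `|G|` at the vertex `v`, which is `0` at all ends. -/
def coordOn (v : V) : WithEnds G → ℝ
  | .point x => x.coord v
  | .ofEnd _ => 0

/-- The common properties of the topologies Top and MTop: `𝒜` is a set of radius functions for
which neighbourhoods of vertex sets are open, and these neighbourhoods form bases at the vertices
and the ends. -/
structure IsEndTopology [TopologicalSpace (WithEnds G)] (𝒜 : Set (G.Dart → ℝ)) : Prop where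
  nonempty : 𝒜.Nonempty
  radius : ∀ r ∈ 𝒜, ∀ d, 0 < r d ∧ r d ≤ 1 / 2
  half : ∀ r ∈ 𝒜, (fun d => r d / 2) ∈ 𝒜
  isOpen_thick : ∀ r ∈ 𝒜, ∀ p, Tame G p → IsOpen (thick p r)
  exists_vertex : ∀ (v : V) (U : Set (WithEnds G)), IsOpen U → .point (vertexPoint G v) ∈ U →
    ∃ r ∈ 𝒜, thick {v} r ⊆ U
  exists_end : ∀ (ω : End G) (U : Set (WithEnds G)), IsOpen U → .ofEnd ω ∈ U →
    ∃ X, ∃ r ∈ 𝒜, thick {v | v ∈ component X ω} r ⊆ U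
  continuous_edge : ∀ d : G.Dart, Continuous fun t => WithEnds.point (edgePoint d t)
  continuous_coord : ∀ v : V, Continuous (coordOn (G := G) v)

theorem exists_coord_ne_zero (x : Point G) : ∃ v, x.coord v ≠ 0 := by
  rcases x.eq_vertexPoint_or with ⟨v, rfl⟩ | ⟨d, t, h0, -, rfl⟩
  · exact ⟨v, by simp [vertexPoint]⟩
  · exact ⟨d.snd, by rw [coord_edgePoint_snd]; exact h0.ne'⟩

theorem exists_component_ne {ω η : End G} (h : ω ≠ η) : ∃ X, component X ω ≠ component X η := by
  by_contra! hcon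
  induction ω using Quotient.ind with
  | _ R =>
    induction η using Quotient.ind with
    | _ S =>
      exact h (Quotient.sound (Ray.equivalent_of_tail fun X => ⟨component X (End.mk R),
        eventually_mem_component R X,
        (hcon X : component X (End.mk R) = component X (End.mk S)) ▸ eventually_mem_component S X⟩))

theorem disjoint_component {X : Finset V} {ω η : End G} (h : component X ω ≠ component X η) :
    Disjoint {v | v ∈ component X ω} {v | v ∈ component X η} :=
  Set.disjoint_left.2 fun _ h1 h2 => h (component_eq_of_mem h1 h2)

/-- The points of the edge `d` at distance more than `b` from `d.fst` and more than `c` from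
`d.snd`, when `b` and `c` are nonnegative. -/
def middle (d : G.Dart) (b c : ℝ) : Set (WithEnds G) :=
  {y | b < coordOn d.snd y ∧ c < coordOn d.fst y}

theorem mem_middle {d : G.Dart} {b c : ℝ} (hb : 0 ≤ b) (hc : 0 ≤ c) {y : WithEnds G} :
    y ∈ middle d b c ↔ ∃ t : unitInterval, 0 < (t : ℝ) ∧ (t : ℝ) < 1 ∧
      y = .point (edgePoint d t) ∧ b < t ∧ c < 1 - t := by
  constructor
  · rintro ⟨h1, h2⟩
    rcases y with x | ω
    · change b < x.coord d.snd at h1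
      change c < x.coord d.fst at h2
      obtain ⟨t, h3, h4, rfl⟩ := eq_edgePoint_of_coord_pos (hc.trans_lt h2) (hb.trans_lt h1)
      rw [coord_edgePoint_snd] at h1
      rw [coord_edgePoint_fst] at h2
      exact ⟨t, h3, h4, rfl, h1, h2⟩
    · exact absurd h1 hb.not_gt
  · rintro ⟨t, -, -, rfl, h1, h2⟩
    refine ⟨?_, ?_⟩
    · change b < (edgePoint d t).coord d.snd
      rwa [coord_edgePoint_snd]
    · change c < (edgePoint d t).coord d.fst
      rwa [coord_edgePoint_fst]

namespace IsEndTopology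

variable [TopologicalSpace (WithEnds G)] {𝒜 : Set (G.Dart → ℝ)}

theorem t2Space (h : IsEndTopology 𝒜) : T2Space (WithEnds G) := by
  refine ⟨fun y z hyz => ?_⟩
  rcases y with x | ω <;> rcases z with x' | η
  · obtain ⟨v, hv⟩ : ∃ v, x.coord v ≠ x'.coord v := by
      by_contra! hcon
      exact hyz (congrArg _ (Point.ext_coord (Finsupp.ext hcon)))
    exact separated_by_continuous (h.continuous_coord v) hv
  · obtain ⟨v, hv⟩ := exists_coord_ne_zero x
    exact separated_by_continuous (h.continuous_coord v) hv
  · obtain ⟨v, hv⟩ := exists_coord_ne_zero x'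
    exact separated_by_continuous (h.continuous_coord v) hv.symm
  · obtain ⟨X, hX⟩ := exists_component_ne fun e => hyz (congrArg _ e)
    obtain ⟨r, hr⟩ := h.nonempty
    exact ⟨_, _, h.isOpen_thick r hr _ (tame_component X ω),
      h.isOpen_thick r hr _ (tame_component X η), ofEnd_mem_thick.2 (livesIn_component X ω),
      ofEnd_mem_thick.2 (livesIn_component X η), disjoint_thick (tame_component X ω)
        (disjoint_component hX) (fun d => (h.radius r hr d).2) fun d => (h.radius r hr d).2⟩

/-- For every open cover of `|G|` there is a partition of the vertex set into parts with
neighbourhoods contained in elements of the cover, such that every end lives in a part. -/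
theorem exists_parts (h : IsEndTopology 𝒜) {α : Type*} {s : α → Set (WithEnds G)}
    (hs : ∀ a, IsOpen (s a)) (hcov : ⋃ a, s a = Set.univ) :
    ∃ Q : Set (Set V), Q.PairwiseDisjoint id ∧ (∀ v, ∃ p ∈ Q, v ∈ p) ∧
      (∀ ω : End G, ∃ p ∈ Q, LivesIn p ω) ∧
      ∀ p ∈ Q, Tame G p ∧ ∃ r ∈ 𝒜, ∃ a, thick p r ⊆ s a := by
  have hmem : ∀ y, ∃ a, y ∈ s a := fun y => Set.mem_iUnion.1 (hcov ▸ Set.mem_univ y)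
  have hend : ∀ ω : End G, ∃ X, ∃ r ∈ 𝒜, ∃ a, thick {v | v ∈ component X ω} r ⊆ s a := by
    intro ω
    obtain ⟨a, ha⟩ := hmem (.ofEnd ω)
    obtain ⟨X, r, hr, hX⟩ := h.exists_end ω _ (hs a) ha
    exact ⟨X, r, hr, a, hX⟩
  choose X r hr a ha using hend
  obtain ⟨P, hP1, hP2, hP3⟩ := solvable_univ X
  refine ⟨P ∪ {p | ∃ v, v ∉ ⋃₀ P ∧ p = {v}}, ?_, fun v => ?_, fun ω => ?_, ?_⟩
  · rintro p (hp | ⟨v, hv, rfl⟩) q (hq | ⟨w, hw, rfl⟩) hpq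
    · exact hP1 hp hq hpq
    · exact Set.disjoint_singleton_right.2 fun hwp => hw ⟨p, hp, hwp⟩
    · exact Set.disjoint_singleton_left.2 fun hvq => hv ⟨q, hq, hvq⟩
    · exact Set.disjoint_singleton.2 fun hvw => hpq (hvw ▸ rfl)
  · by_cases hv : v ∈ ⋃₀ P
    · obtain ⟨p, hp, hvp⟩ := hv
      exact ⟨p, Or.inl hp, hvp⟩
    · exact ⟨{v}, Or.inr ⟨v, hv, rfl⟩, rfl⟩
  · induction ω using Quotient.ind with
    | _ R =>
      obtain ⟨p, hp, hRp⟩ := hP3 R (by simp)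
      exact ⟨p, Or.inl hp, R, rfl, hRp⟩
  · rintro p (hp | ⟨v, -, rfl⟩)
    · obtain ⟨h1, ⟨ω, hω⟩, -⟩ := hP2 p hp
      exact ⟨Or.inl h1, r ω, hr ω, a ω, (thick_mono hω fun _ => le_rfl).trans (ha ω)⟩
    · obtain ⟨a, ha⟩ := hmem (.point (vertexPoint G v))
      obtain ⟨r, hr, hra⟩ := h.exists_vertex v _ (hs a) ha
      exact ⟨Or.inr Set.subsingleton_singleton, r, hr, a, hra⟩

/-- Given a partition of the vertices as in `exists_parts`, the neighbourhoods of the parts cover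
everything but compact segments of the edges between different parts. These are covered by finitely
many open sets each, restricted to the interior of the edge. -/
theorem paracompactSpace (h : IsEndTopology 𝒜) : ParacompactSpace (WithEnds G) := by
  classical
  refine ⟨fun α s hs hcov => ?_⟩
  obtain ⟨Q, hQ1, hQ2, hQ3, hQ4⟩ := h.exists_parts hs hcov
  choose π hπ hmemπ using hQ2
  choose! r hr using fun p hp => (hQ4 p hp).2
  have hpart : ∀ p ∈ Q, ∀ v ∈ p, π v = p := fun p hp v hv =>
    hQ1.elim (hπ v) hp (Set.not_disjoint_iff.2 ⟨v, hmemπ v, hv⟩)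
  have hrad : ∀ p ∈ Q, ∀ d, 0 < r p d ∧ r p d ≤ 1 / 2 := fun p hp => h.radius _ (hr p hp).1
  have hhalf : ∀ p ∈ Q, ∀ d, r p d / 2 ≤ r p d := fun p hp d => by linarith [(hrad p hp d).1]
  let ρ : G.Dart → ℝ := fun d => r (π d.fst) d
  have hρ : ∀ d, 0 < ρ d ∧ ρ d ≤ 1 / 2 := fun d => hrad _ (hπ _) d
  -- The edges between different parts.
  let D : Set G.Dart := {d | π d.fst ≠ π d.snd}
  have hD : ∀ d ∈ D, ∀ p ∈ Q, d.fst ∈ p → d.snd ∈ p → False := fun d hd p hp h1 h2 =>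
    hd ((hpart p hp _ h1).trans (hpart p hp _ h2).symm)
  -- Every edge is compact, hence contained in the union of finitely many sets of the cover.
  have hF : ∀ d : G.Dart, ∃ F : Finset α, ∀ t, ∃ a ∈ F, WithEnds.point (edgePoint d t) ∈ s a := by
    intro d
    obtain ⟨F, hF⟩ := isCompact_univ.elim_finite_subcover
      (fun a => (fun t => WithEnds.point (edgePoint d t)) ⁻¹' s a)
      (fun a => (hs a).preimage (h.continuous_edge d)) fun t _ => by
        rw [← Set.preimage_iUnion, hcov]
        trivial
    exact ⟨F, fun t => by simpa using hF (Set.mem_univ t)⟩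
  choose F hF using hF
  have hmid : ∀ {d : G.Dart} {y}, y ∈ middle d (ρ d / 2) (ρ d.symm / 2) ↔ _ := fun {d} {y} =>
    mem_middle (y := y) (half_pos (hρ d).1).le (half_pos (hρ d.symm).1).le
  have hmid_open : ∀ (d : G.Dart) b c, IsOpen (middle d b c) := fun d b c =>
    (isOpen_lt continuous_const (h.continuous_coord d.snd)).inter
      (isOpen_lt continuous_const (h.continuous_coord d.fst))
  have hcases : ∀ y : WithEnds G, (∃ p ∈ Q, y ∈ thick p fun d => r p d / 2) ∨
      ∃ d ∈ D, ∃ t : unitInterval, 0 < (t : ℝ) ∧ (t : ℝ) < 1 ∧ y = .point (edgePoint d t) := by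
    rintro (x | ω)
    · rcases x.eq_vertexPoint_or with ⟨v, rfl⟩ | ⟨d, t, h0, h1, rfl⟩
      · refine Or.inl ⟨π v, hπ v, point_mem_thick.2 ((vertexPoint_mem_trace fun d => ?_).2
          (hmemπ v))⟩
        linarith [hrad _ (hπ v) d]
      · by_cases hd : d ∈ D
        · exact Or.inr ⟨d, hd, t, h0, h1, rfl⟩
        · refine Or.inl ⟨π d.fst, hπ _,
            point_mem_thick.2 (edgePoint_mem_trace_of_mem (hmemπ _) ?_ t)⟩
          rw [not_not.1 hd]
          exact hmemπ _
    · obtain ⟨p, hp, hω⟩ := hQ3 ω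
      exact Or.inl ⟨p, hp, ofEnd_mem_thick.2 hω⟩
  refine ⟨Q ⊕ (Σ d : D, F d), Sum.elim (fun p => thick p (r p))
    (fun i => s i.2 ∩ middle i.1 (ρ i.1 / 2) (ρ (i.1 : G.Dart).symm / 2)), ?_, ?_, ?_, ?_⟩
  · rintro (p | i)
    · exact h.isOpen_thick _ (hr p p.2).1 _ (hQ4 p p.2).1
    · exact (hs _).inter (hmid_open _ _ _)
  · refine Set.eq_univ_of_forall fun y => Set.mem_iUnion.2 ?_
    rcases hcases y with ⟨p, hp, hy⟩ | ⟨d, hd, t, h0, h1, rfl⟩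
    · exact ⟨.inl ⟨p, hp⟩, thick_mono subset_rfl (hhalf p hp) hy⟩
    · by_cases ht : (t : ℝ) < ρ d
      · exact ⟨.inl ⟨_, hπ d.fst⟩, point_mem_thick.2 (edgePoint_mem_trace_of_lt (hmemπ _) ht)⟩
      by_cases ht' : 1 - (t : ℝ) < ρ d.symm
      · exact ⟨.inl ⟨_, hπ d.snd⟩, point_mem_thick.2 ((edgePoint_mem_trace_iff_of_pos h0 h1).2
          (Or.inr (Or.inr ⟨hmemπ _, ht'⟩)))⟩
      obtain ⟨a, ha, hat⟩ := hF d t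
      refine ⟨.inr ⟨⟨d, hd⟩, a, ha⟩, hat, hmid.2 ⟨t, h0, h1, rfl, ?_, ?_⟩⟩
      · linarith [hρ d]
      · linarith [hρ d.symm]
  · intro y
    rcases hcases y with ⟨p, hp, hy⟩ | ⟨d, hd, t, h0, h1, rfl⟩
    -- The neighbourhood of a part with halved radii meets no other member of the family, since the
    -- members inside edges keep more than this distance from the endvertices.
    · refine ⟨_, (h.isOpen_thick _ (h.half _ (hr p hp).1) p (hQ4 p hp).1).mem_nhds hy,
        (Set.finite_singleton (.inl ⟨p, hp⟩)).subset ?_⟩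
      rintro (q | ⟨⟨d, hd⟩, a⟩) ⟨z, hz1, hz2⟩
      · by_contra hqp
        have hne : (q : Set V) ≠ p := fun e => hqp (congrArg Sum.inl (Subtype.ext e))
        exact Set.disjoint_left.1 (disjoint_thick (hQ4 q q.2).1 (hQ1 q.2 hp hne)
          (fun d => (hrad q q.2 d).2) fun d => (hrad p hp d).2) hz1
            (thick_mono subset_rfl (hhalf p hp) hz2)
      · obtain ⟨t, h0, h1, rfl, h2, h3⟩ := hmid.1 hz1.2
        rw [point_mem_thick, edgePoint_mem_trace_iff_of_pos h0 h1] at hz2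
        rcases hz2 with ⟨h4, h5⟩ | ⟨h4, h5⟩ | ⟨h4, h5⟩
        · exact (hD d hd p hp h4 h5).elim
        · have : ρ d = r p d := by simp only [ρ, hpart p hp _ h4]
          linarith
        · have : ρ d.symm = r p d.symm := by
            simp only [ρ]
            rw [hpart p hp _ (show d.symm.fst ∈ p from h4)]
          linarith
    -- The interior of an edge meets only the neighbourhoods of the parts of its endvertices and the
    -- finitely many members inside this edge, in either orientation.
    · have hd' : d.symm ∈ D := fun e => hd e.symm
      refine ⟨middle d 0 0, (hmid_open d 0 0).mem_nhds
        ((mem_middle le_rfl le_rfl).2 ⟨t, h0, h1, rfl, h0, by linarith⟩), Set.Finite.subset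
        ((Set.toFinite {Sum.inl ⟨_, hπ d.fst⟩, Sum.inl ⟨_, hπ d.snd⟩}).union
          (((Set.finite_range (Sigma.mk (⟨d, hd⟩ : D))).union
            (Set.finite_range (Sigma.mk (⟨d.symm, hd'⟩ : D)))).image Sum.inr)) ?_⟩
      rintro (q | ⟨⟨e, he⟩, a⟩) ⟨z, hz1, hz2⟩
      · obtain ⟨t, h0, h1, rfl, -⟩ := (mem_middle le_rfl le_rfl).1 hz2
        have hz1' := (edgePoint_mem_trace_iff_of_pos h0 h1).1 (point_mem_thick.1 hz1)
        refine Or.inl ?_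
        have : d.fst ∈ (q : Set V) ∨ d.snd ∈ (q : Set V) := by tauto
        rcases this with hq | hq
        · exact Or.inl (congrArg Sum.inl (Subtype.ext (hpart q q.2 _ hq).symm))
        · exact Or.inr (congrArg Sum.inl (Subtype.ext (hpart q q.2 _ hq).symm))
      · refine Or.inr ⟨⟨⟨e, he⟩, a⟩, ?_, rfl⟩
        obtain ⟨t, h0, h1, rfl, -⟩ := hmid.1 hz1.2
        rcases dart_eq_of_coord_pos hz2.2 hz2.1 with rfl | rfl
        · exact Or.inl ⟨a, rfl⟩
        · exact Or.inr ⟨a, rfl⟩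
  · rintro (p | i)
    · exact (hr p p.2).2
    · exact ⟨i.2, Set.inter_subset_left⟩

end IsEndTopology

end

/-! ### Topologies generated by neighbourhoods of ends -/

section

variable {V : Type u} {G : SimpleGraph V}

theorem point_injective : Function.Injective (WithEnds.point (G := G)) :=
  fun _ _ h => by injection h

/-- Criterion for a topology generated by the open sets of `G` and neighbourhoods of ends. The
hypotheses `isOpen_preimage` and `exists_thick` say that the generators in `N` induce no new open
sets on `G`, and that the sets `thick {v | v ∈ component X ω} r` form bases at the ends. -/
theorem isEndTopology_generateFrom (σ : TopologicalSpace (Point G)) (N : Set (Set (WithEnds G)))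
    (𝒜 : Set (G.Dart → ℝ)) (radius : ∀ r ∈ 𝒜, ∀ d, 0 < r d ∧ r d ≤ 1 / 2)
    (half : ∀ r ∈ 𝒜, (fun d => r d / 2) ∈ 𝒜)
    (inf : ∀ r ∈ 𝒜, ∀ s ∈ 𝒜, ∃ t ∈ 𝒜, ∀ d, t d ≤ r d ∧ t d ≤ s d)
    (small : ∀ ε : ℝ, 0 < ε → ∃ r ∈ 𝒜, ∀ d, r d ≤ ε)
    (isOpen_preimage : ∀ W ∈ N, IsOpen[σ] (WithEnds.point ⁻¹' W))
    (thick_mem : ∀ r ∈ 𝒜, ∀ (X : Finset V) (ω : End G), thick {v | v ∈ component X ω} r ∈ N)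
    (exists_thick : ∀ W ∈ N, ∀ ω, WithEnds.ofEnd ω ∈ W →
      ∃ X, ∃ r ∈ 𝒜, thick {v | v ∈ component X ω} r ⊆ W)
    (isOpen_trace : ∀ r ∈ 𝒜, ∀ p, IsOpen[σ] (trace p r))
    (continuous_edge : ∀ d : G.Dart, Continuous[_, σ] (edgePoint d))
    (continuous_coord : ∀ v : V, Continuous[σ, _] fun x : Point G => x.coord v)
    (exists_trace : ∀ (v : V) (U : Set (Point G)), IsOpen[σ] U → vertexPoint G v ∈ U →
      ∃ r ∈ 𝒜, trace {v} r ⊆ U) :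
    @IsEndTopology V G (TopologicalSpace.generateFrom
      ({W | ∃ U : Set (Point G), IsOpen[σ] U ∧ W = WithEnds.point '' U} ∪ N)) 𝒜 := by
  let τ : TopologicalSpace (WithEnds G) := TopologicalSpace.generateFrom
      ({W | ∃ U : Set (Point G), IsOpen[σ] U ∧ W = WithEnds.point '' U} ∪ N)
  have hopen : ∀ U : Set (Point G), IsOpen[σ] U → IsOpen (WithEnds.point '' U) := fun U hU =>
    TopologicalSpace.isOpen_generateFrom_of_mem (Or.inl ⟨U, hU, rfl⟩)
  have hcont : Continuous[σ, τ] WithEnds.point := by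
    refine continuous_generateFrom_iff.2 ?_
    rintro W (⟨U, hU, rfl⟩ | hW)
    · rwa [Set.preimage_image_eq _ point_injective]
    · exact isOpen_preimage W hW
  have hthick : ∀ r ∈ 𝒜, ∀ (X : Finset V) (ω : End G),
      IsOpen (thick {v | v ∈ component X ω} r) := fun r hr X ω =>
    TopologicalSpace.isOpen_generateFrom_of_mem (Or.inr (thick_mem r hr X ω))
  refine
    { nonempty := (small 1 one_pos).imp fun _ h => h.1
      radius := radius
      half := half
      isOpen_thick := fun r hr p hp => isOpen_iff_forall_mem_open.2 ?_
      exists_vertex := fun v U hU hv => ?_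
      exists_end := fun ω U hU => ?_
      continuous_edge := fun d => hcont.comp (continuous_edge d)
      continuous_coord := fun v => ⟨fun O hO => isOpen_iff_forall_mem_open.2 ?_⟩ }
  · rintro (x | ω) hy
    · exact ⟨_, Set.subset_union_left, hopen _ (isOpen_trace r hr p), x, point_mem_thick.1 hy, rfl⟩
    · rw [ofEnd_mem_thick] at hy
      rcases hp with hp | hp
      · refine ⟨_, thick_mono ?_ fun _ => le_rfl, hthick r hr hp.toFinset ω,
          ofEnd_mem_thick.2 (livesIn_component _ ω)⟩
        exact fun v hv => hy.component_subset (by simp) hv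
      · exact (not_livesIn_of_subsingleton hp ω hy).elim
  · obtain ⟨r, hr, hrU⟩ := exists_trace v _ (hU.preimage hcont) hv
    refine ⟨r, hr, ?_⟩
    rintro (x | ω) hy
    · exact hrU (point_mem_thick.1 hy)
    · exact (not_livesIn_of_subsingleton Set.subsingleton_singleton ω (ofEnd_mem_thick.1 hy)).elim
  · intro hω
    induction hU with
    | basic W hW =>
      rcases hW with ⟨U, -, rfl⟩ | hW
      · obtain ⟨x, -, hx⟩ := hω
        cases hx
      · exact exists_thick W hW ω hω
    | univ =>
      obtain ⟨r, hr, -⟩ := small 1 one_pos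
      exact ⟨∅, r, hr, Set.subset_univ _⟩
    | inter U W _ _ ihU ihW =>
      classical
      obtain ⟨X, r, hr, hX⟩ := ihU hω.1
      obtain ⟨Y, s, hs, hY⟩ := ihW hω.2
      obtain ⟨t, ht, htrs⟩ := inf r hr s hs
      exact ⟨X ∪ Y, t, ht, Set.subset_inter
        ((thick_mono (component_subset_component Finset.subset_union_left ω)
          fun d => (htrs d).1).trans hX)
        ((thick_mono (component_subset_component Finset.subset_union_right ω)
          fun d => (htrs d).2).trans hY)⟩
    | sUnion S _ ih =>
      obtain ⟨U, hUS, hωU⟩ := hω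
      obtain ⟨X, r, hr, hX⟩ := ih U hUS hωU
      exact ⟨X, r, hr, hX.trans (Set.subset_sUnion_of_mem hUS)⟩
  · rintro (x | ω) hy
    · refine ⟨WithEnds.point '' ((fun x : Point G => x.coord v) ⁻¹' O), ?_,
        hopen _ (hO.preimage (continuous_coord v)), x, hy, rfl⟩
      rintro _ ⟨x, hx, rfl⟩
      exact hx
    -- If `v ∈ X`, then the points of `C(X, ω)` have coordinate `0` at `v`, and those on the edges
    -- that leave `C(X, ω)` have coordinate less than the radius.
    · obtain ⟨ε, hε, hεO⟩ := Metric.isOpen_iff.1 hO 0 hy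
      obtain ⟨r, hr, hrε⟩ := small ε hε
      refine ⟨_, ?_, hthick r hr {v} ω, ofEnd_mem_thick.2 (livesIn_component _ ω)⟩
      rintro (x | η) hx
      · have hv : v ∉ component {v} ω := fun h => notMem_of_mem_component h (by simp)
        have hx0 : x.coord v = 0 ∨ ∃ t : unitInterval, x.coord v = t ∧ (t : ℝ) < ε := by
          rcases point_mem_thick.1 hx with h | ⟨d, h1, h2, t, ht, rfl⟩
          · exact Or.inl (Finsupp.notMem_support_iff.1 fun h' => hv (h v h'))
          · by_cases hvd : v = d.snd
            · exact Or.inr ⟨t, by rw [hvd, coord_edgePoint_snd], ht.trans_le (hrε d)⟩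
            · exact Or.inl (coord_edgePoint_of_ne (fun h => hv (Set.mem_of_eq_of_mem h h1)) hvd t)
        refine hεO ?_
        rw [Metric.mem_ball, Real.dist_eq, sub_zero]
        change |x.coord v| < ε
        rcases hx0 with h | ⟨t, h, ht⟩
        · rwa [h, abs_zero]
        · rwa [h, abs_of_nonneg t.2.1]
      · exact hy

theorem linearMap_edgePoint (φ : (V →₀ ℝ) →ₗ[ℝ] ℝ) (d : G.Dart) (t : unitInterval) :
    φ (edgePoint d t).coord =
      (1 - t) * φ (Finsupp.single d.fst 1) + t * φ (Finsupp.single d.snd 1) := by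
  simp only [edgePoint, AffineMap.lineMap_apply_module, map_add, map_smul, smul_eq_mul]

/-! ### The topology Top -/

theorem isOpen_complexTopology {U : Set (Point G)} :
    IsOpen[complexTopology G] U ↔ ∀ d : G.Dart, IsOpen (edgePoint d ⁻¹' U) := by
  simp only [isOpen_iSup_iff, isOpen_coinduced]

theorem isOpen_trace_complexTopology (p : Set V) {r : G.Dart → ℝ} (hr : ∀ d, 0 < r d ∧ r d ≤ 1) :
    IsOpen[complexTopology G] (trace p r) := by
  refine isOpen_complexTopology.2 fun d => ?_
  have : edgePoint d ⁻¹' trace p r = {t : unitInterval | d.fst ∈ p ∧ d.snd ∈ p} ∪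
      ({t : unitInterval | d.fst ∈ p ∧ (t : ℝ) < r d} ∪
        {t : unitInterval | d.snd ∈ p ∧ 1 - (t : ℝ) < r d.symm}) :=
    Set.ext fun t => edgePoint_mem_trace hr
  rw [this]
  exact isOpen_const.union ((isOpen_const.and
    (isOpen_lt continuous_subtype_val continuous_const)).union (isOpen_const.and
      (isOpen_lt (continuous_const.sub continuous_subtype_val) continuous_const)))

theorem isEndTopology_spaceTop (G : SimpleGraph V) :
    @IsEndTopology V G (spaceTop G) {r | ∀ d, 0 < r d ∧ r d ≤ 1 / 2} := by
  have hone : ∀ {r : G.Dart → ℝ}, (∀ d, 0 < r d ∧ r d ≤ 1 / 2) → ∀ d, 0 < r d ∧ r d ≤ 1 :=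
    fun hr d => ⟨(hr d).1, (hr d).2.trans (by norm_num)⟩
  refine isEndTopology_generateFrom (complexTopology G) _ _ (fun r hr => hr) (fun r hr d => ?_)
    (fun r hr s hs => ⟨fun d => min (r d) (s d), fun d => ?_, fun d =>
      ⟨min_le_left _ _, min_le_right _ _⟩⟩)
    (fun ε hε => ⟨fun _ => min ε (1 / 2), fun d => ⟨by positivity, min_le_right _ _⟩, fun d =>
      min_le_left _ _⟩) ?_ ?_ ?_ (fun r hr p => isOpen_trace_complexTopology p (hone hr))
      (fun d => ?_) (fun v => ?_) ?_
  · constructor <;> linarith [hr d]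
  · exact ⟨lt_min (hr d).1 (hs d).1, (min_le_left _ _).trans (hr d).2⟩
  · rintro W ⟨X, ω, r, hr, rfl⟩
    rw [nhdTop_eq_thick]
    convert isOpen_trace_complexTopology {v | v ∈ component X ω} hr using 1
    exact Set.ext fun x => point_mem_thick
  · exact fun r hr X ω => ⟨X, ω, r, hone hr, (nhdTop_eq_thick X ω r).symm⟩
  · rintro W ⟨X, ω, r, hr, rfl⟩ η hη
    rw [nhdTop_eq_thick, ofEnd_mem_thick, ← mem_endsIn_iff] at hη
    refine ⟨X, fun d => min (r d) (1 / 2), fun d => ⟨lt_min (hr d).1 (by norm_num),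
      min_le_right _ _⟩, ?_⟩
    rw [nhdTop_eq_thick, show component X η = component X ω from hη]
    exact thick_mono subset_rfl fun d => min_le_left _ _
  · exact continuous_iSup_rng (i := d) continuous_coinduced_rng
  · refine continuous_iSup_dom.2 fun d => continuous_coinduced_dom.2 ?_
    change Continuous fun t => Finsupp.lapply (R := ℝ) v (edgePoint d t).coord
    simp only [linearMap_edgePoint]
    fun_prop
  · intro v U hU hv
    have : ∀ d : G.Dart, ∃ ε : ℝ, 0 < ε ∧ (d.fst = v → ∀ t : unitInterval, (t : ℝ) < ε →
        edgePoint d t ∈ U) := by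
      intro d
      by_cases hd : d.fst = v
      · obtain ⟨ε, hε, h⟩ := Metric.isOpen_iff.1 (isOpen_complexTopology.1 hU d) 0
          (by rwa [Set.mem_preimage, edgePoint_zero, hd])
        refine ⟨ε, hε, fun _ t ht => h ?_⟩
        rw [Metric.mem_ball, Subtype.dist_eq, Real.dist_eq]
        simpa [abs_of_nonneg t.2.1] using ht
      · exact ⟨1, one_pos, fun h => (hd h).elim⟩
    choose ε hε hεU using this
    refine ⟨fun d => min (ε d) (1 / 2), fun d => ⟨lt_min (hε d) (by norm_num), min_le_right _ _⟩,
      ?_⟩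
    intro x hx
    rcases eq_or_eq_edgePoint_of_mem_trace_singleton hx with rfl | ⟨d, t, h1, ht, rfl⟩
    · exact hv
    · exact hεU d h1 t (ht.trans_le (min_le_left _ _))

/-! ### The topology MTop -/

/-- Linear functionals that take values in `[0, 1]` at the vertices do not increase distances. -/
theorem PathOfLength.abs_sub_le {φ : (V →₀ ℝ) →ₗ[ℝ] ℝ}
    (hφ : ∀ v, φ (Finsupp.single v 1) ∈ Set.Icc (0 : ℝ) 1) {x y : Point G} {l : ℝ≥0}
    (h : PathOfLength x y l) : |φ x.coord - φ y.coord| ≤ l := by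
  induction h with
  | refl => simp
  | step d s t l _ ih =>
    have key : |φ (edgePoint d s).coord - φ (edgePoint d t).coord| ≤ |(s : ℝ) - t| := by
      have e : φ (edgePoint d s).coord - φ (edgePoint d t).coord =
          (s - t) * (φ (Finsupp.single d.snd 1) - φ (Finsupp.single d.fst 1)) := by
        rw [linearMap_edgePoint, linearMap_edgePoint]
        ring
      rw [e, abs_mul]
      refine mul_le_of_le_one_right (abs_nonneg _) (abs_le.2 ⟨?_, ?_⟩) <;>
        linarith [(hφ d.fst).1, (hφ d.fst).2, (hφ d.snd).1, (hφ d.snd).2]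
    have e : ((nndist s t : ℝ≥0) : ℝ) = |(s : ℝ) - t| := by
      rw [coe_nndist, Subtype.dist_eq, Real.dist_eq]
    rw [NNReal.coe_add, e]
    exact (_root_.abs_sub_le _ _ _).trans (add_le_add ih key)

theorem continuous_linearMap_lengthTopology {φ : (V →₀ ℝ) →ₗ[ℝ] ℝ}
    (hφ : ∀ v, φ (Finsupp.single v 1) ∈ Set.Icc (0 : ℝ) 1) :
    Continuous[lengthTopology G, _] fun x : Point G => φ x.coord := by
  let _ := lengthMetric G
  refine LipschitzWith.continuous (K := 1) fun x y => ?_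
  rw [ENNReal.coe_one, one_mul]
  refine le_iInf₂ fun l hl => ?_
  rw [edist_dist, Real.dist_eq]
  exact ENNReal.ofReal_le_of_le_toReal (by simpa using PathOfLength.abs_sub_le hφ hl)

/-- The total weight of the coordinates of a point at the vertices of `p`. -/
noncomputable def mass (p : Set V) : (V →₀ ℝ) →ₗ[ℝ] ℝ :=
  Finsupp.linearCombination ℝ (p.indicator 1)

theorem mass_single (p : Set V) (v : V) :
    mass p (Finsupp.single v 1) = p.indicator (1 : V → ℝ) v := by
  simp [mass]

theorem mass_single_mem_Icc (p : Set V) (v : V) :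
    mass p (Finsupp.single v 1) ∈ Set.Icc (0 : ℝ) 1 := by
  rw [mass_single]
  by_cases h : v ∈ p <;> simp [h]

theorem mass_eq_one_of_mem {p : Set V} {x : Point G} (h : ∀ v ∈ x.coord.support, v ∈ p) :
    mass p x.coord = 1 := by
  rcases x.eq_vertexPoint_or with ⟨v, rfl⟩ | ⟨d, t, h0, h1, rfl⟩
  · have hv : v ∈ p := h v (by simp [vertexPoint])
    rw [vertexPoint, mass_single]
    simp [hv]
  · have e1 : d.fst ∈ p := h _ (by
      rw [Finsupp.mem_support_iff, coord_edgePoint_fst]; linarith)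
    have e2 : d.snd ∈ p := h _ (by
      rw [Finsupp.mem_support_iff, coord_edgePoint_snd]; exact h0.ne')
    rw [linearMap_edgePoint, mass_single, mass_single]
    simp [e1, e2]

/-- For a constant radius the neighbourhood of a vertex set is an open superlevel set of a Lipschitz
function. -/
theorem mem_trace_const_iff {p : Set V} {ε : ℝ} (h0 : 0 < ε) (h1 : ε ≤ 1) {x : Point G} :
    x ∈ trace p (fun _ => ε) ↔ 1 - ε < mass p x.coord := by
  rcases x.eq_vertexPoint_or with ⟨v, rfl⟩ | ⟨d, t, ht0, ht1, rfl⟩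
  · rw [vertexPoint_mem_trace fun _ => h1, vertexPoint, mass_single]
    by_cases hv : v ∈ p <;> simp [hv, h0, h1]
  · rw [edgePoint_mem_trace_iff_of_pos ht0 ht1, linearMap_edgePoint, mass_single, mass_single]
    by_cases hf : d.fst ∈ p <;> by_cases hs : d.snd ∈ p
    · simp [hf, hs, h0]
    · simp [hf, hs]
    · simp only [hf, hs, Set.indicator, if_true, if_false, Pi.one_apply]
      constructor
      · rintro (h | h | h)
        · exact h.1.elim
        · exact h.1.elim
        · linarith [h.2]
      · intro h
        exact Or.inr (Or.inr ⟨trivial, by linarith⟩)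
    · simp [hf, hs, h1]

theorem isOpen_trace_lengthTopology (p : Set V) {ε : ℝ} (h0 : 0 < ε) (h1 : ε ≤ 1) :
    IsOpen[lengthTopology G] (trace p fun _ => ε) := by
  have : trace p (fun _ : G.Dart => ε) = (fun x : Point G => mass p x.coord) ⁻¹' Set.Ioi (1 - ε) :=
    Set.ext fun x => mem_trace_const_iff h0 h1
  rw [this]
  let _ := lengthTopology G
  exact isOpen_Ioi.preimage (continuous_linearMap_lengthTopology (mass_single_mem_Icc p))

theorem lengthDist_edgePoint_le (d : G.Dart) (s t : unitInterval) :
    lengthDist (edgePoint d s) (edgePoint d t) ≤ edist s t := by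
  have h := PathOfLength.step (edgePoint d s) d s t 0 (.refl _)
  exact (iInf₂_le _ h).trans (by rw [zero_add, edist_nndist])

theorem lengthDist_lt_of_lt (d : G.Dart) {t : unitInterval} {ε : ℝ} (ht : (t : ℝ) < ε) :
    lengthDist (edgePoint d t) (vertexPoint G d.fst) < ENNReal.ofReal ε := by
  rw [← edgePoint_zero]
  refine (lengthDist_edgePoint_le d t 0).trans_lt ?_
  rw [edist_dist, Subtype.dist_eq, Real.dist_eq]
  refine (ENNReal.ofReal_lt_ofReal_iff (t.2.1.trans_lt ht)).2 ?_
  simpa [abs_of_nonneg t.2.1] using ht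

theorem componentPoints_subset_ballAround (X : Finset V) (ω : End G) {ε : ℝ} (h0 : 0 < ε) :
    componentPoints X ω ⊆ ballAround X ω ε := fun x hx =>
  ⟨x, hx, ((lengthMetric G).edist_self x).trans_lt (ENNReal.ofReal_pos.2 h0)⟩

theorem ballAround_eq_trace (X : Finset V) (ω : End G) {ε : ℝ} (h0 : 0 < ε) (h1 : ε ≤ 1) :
    ballAround X ω ε = trace {v | v ∈ component X ω} fun _ => ε := by
  apply Set.Subset.antisymm
  · rintro x ⟨y, hy, hxy⟩
    rw [mem_trace_const_iff h0 h1]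
    obtain ⟨l, hl, hlε⟩ : ∃ l : ℝ≥0, PathOfLength x y l ∧ (l : ℝ≥0∞) < ENNReal.ofReal ε := by
      simpa [lengthDist, iInf_lt_iff] using hxy
    have hl' : (l : ℝ) < ε := by
      rw [← ENNReal.ofReal_coe_nnreal] at hlε
      exact (ENNReal.ofReal_lt_ofReal_iff h0).1 hlε
    have hy1 := mass_eq_one_of_mem (p := {v | v ∈ component X ω}) hy
    have := (abs_le.1 (PathOfLength.abs_sub_le (mass_single_mem_Icc {v | v ∈ component X ω}) hl)).1
    linarith
  · rintro x (h | ⟨d, hd, -, t, ht, rfl⟩)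
    · exact componentPoints_subset_ballAround X ω h0 h
    · refine ⟨vertexPoint G d.fst, fun v hv => ?_, lengthDist_lt_of_lt d ht⟩
      obtain rfl : d.fst = v := by
        by_contra hne
        simp [vertexPoint] at hv
        exact hne hv.symm
      exact hd

theorem ballAround_mono (X : Finset V) (ω : End G) {ε δ : ℝ} (h : ε ≤ δ) :
    ballAround X ω ε ⊆ ballAround X ω δ := fun _ ⟨y, hy, hxy⟩ =>
  ⟨y, hy, hxy.trans_le (ENNReal.ofReal_le_ofReal h)⟩

theorem nhdMTop_eq_thick (X : Finset V) (ω : End G) {ε : ℝ} (h0 : 0 < ε) (h1 : ε ≤ 1) :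
    nhdMTop X ω ε = thick {v | v ∈ component X ω} fun _ => ε := by
  rw [nhdMTop, thick, ← ballAround_eq_trace X ω h0 h1, Set.union_right_comm, ← Set.image_union,
    Set.union_eq_right.2 (componentPoints_subset_ballAround X ω h0)]
  congr 2
  ext η
  exact mem_endsIn_iff

theorem isOpen_ballAround (X : Finset V) (ω : End G) (ε : ℝ) :
    IsOpen[lengthTopology G] (ballAround X ω ε) := by
  let _ := lengthMetric G
  have : ballAround X ω ε = ⋃ y ∈ componentPoints X ω, Metric.eball y (ENNReal.ofReal ε) := by
    ext x
    simp only [Set.mem_iUnion, exists_prop]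
    rfl
  rw [this]
  exact isOpen_biUnion fun _ _ => Metric.isOpen_eball

theorem isEndTopology_spaceMTop (G : SimpleGraph V) :
    @IsEndTopology V G (spaceMTop G) {r | ∃ ε : ℝ, (0 < ε ∧ ε ≤ 1 / 2) ∧ r = fun _ => ε} := by
  refine isEndTopology_generateFrom (lengthTopology G) _ _ ?_ ?_ ?_
    (fun ε hε => ⟨_, ⟨min ε (1 / 2), ⟨by positivity, min_le_right _ _⟩, rfl⟩, fun d =>
      min_le_left _ _⟩) ?_ ?_ ?_ ?_ (fun d => ?_) (fun v => ?_) ?_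
  · rintro _ ⟨ε, hε, rfl⟩ d
    exact hε
  · rintro _ ⟨ε, hε, rfl⟩
    exact ⟨ε / 2, by constructor <;> linarith, rfl⟩
  · rintro _ ⟨ε, hε, rfl⟩ _ ⟨δ, hδ, rfl⟩
    exact ⟨_, ⟨min ε δ, ⟨lt_min hε.1 hδ.1, (min_le_left _ _).trans hε.2⟩, rfl⟩, fun d =>
      ⟨min_le_left _ _, min_le_right _ _⟩⟩
  · rintro W ⟨X, ω, ε, hε, rfl⟩
    convert isOpen_ballAround X ω ε using 1
    ext x
    have : x ∈ componentPoints X ω → x ∈ ballAround X ω ε :=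
      fun h => componentPoints_subset_ballAround X ω hε h
    simpa [nhdMTop] using this
  · rintro _ ⟨ε, hε, rfl⟩ X ω
    exact ⟨X, ω, ε, hε.1, (nhdMTop_eq_thick X ω hε.1 (hε.2.trans (by norm_num))).symm⟩
  · rintro W ⟨X, ω, ε, hε, rfl⟩ η hη
    have hη' : component X η = component X ω := by simpa [nhdMTop, endsIn] using hη
    have hδ : 0 < min ε (1 / 2) := lt_min hε (by norm_num)
    refine ⟨X, _, ⟨min ε (1 / 2), ⟨hδ, min_le_right _ _⟩, rfl⟩, ?_⟩
    rw [hη', ← nhdMTop_eq_thick X ω hδ ((min_le_right _ _).trans (by norm_num))]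
    exact Set.union_subset_union_right _ (Set.image_mono (ballAround_mono X ω (min_le_left _ _)))
  · rintro _ ⟨ε, hε, rfl⟩ p
    exact isOpen_trace_lengthTopology p hε.1 (hε.2.trans (by norm_num))
  · let _ := lengthMetric G
    exact LipschitzWith.continuous (K := 1) fun s t => by
      rw [ENNReal.coe_one, one_mul]
      exact lengthDist_edgePoint_le d s t
  · refine continuous_linearMap_lengthTopology (φ := Finsupp.lapply v) fun w => ?_
    by_cases h : w = v <;> simp [h]
  · intro v U hU hv
    let _ := lengthMetric G
    obtain ⟨ε, hε, hεU⟩ := EMetric.isOpen_iff.1 hU _ hv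
    obtain ⟨δ, hδ, hδε⟩ : ∃ δ : ℝ, (0 < δ ∧ δ ≤ 1 / 2) ∧ ENNReal.ofReal δ ≤ ε := by
      have hne : min ε (ENNReal.ofReal (1 / 2)) ≠ ⊤ :=
        ((min_le_right _ _).trans_lt ENNReal.ofReal_lt_top).ne
      refine ⟨(min ε (ENNReal.ofReal (1 / 2))).toReal, ⟨ENNReal.toReal_pos ?_ hne, ?_⟩, ?_⟩
      · exact (lt_min hε (ENNReal.ofReal_pos.2 (by norm_num))).ne'
      · exact ENNReal.toReal_le_of_le_ofReal (by norm_num) (min_le_right _ _)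
      · rw [ENNReal.ofReal_toReal hne]
        exact min_le_left _ _
    refine ⟨_, ⟨δ, hδ, rfl⟩, fun x hx => ?_⟩
    rcases eq_or_eq_edgePoint_of_mem_trace_singleton hx with rfl | ⟨d, t, rfl, ht, rfl⟩
    · exact hv
    · exact hεU ((lengthDist_lt_of_lt d ht).trans_le hδε)

end

end GraphEnds

theorem mainTheorem3 {V : Type u} (G : SimpleGraph V) :
    (@T2Space (GraphEnds.WithEnds G) (GraphEnds.spaceTop G) ∧
      @ParacompactSpace (GraphEnds.WithEnds G) (GraphEnds.spaceTop G)) ∧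
    (@T2Space (GraphEnds.WithEnds G) (GraphEnds.spaceMTop G) ∧
      @ParacompactSpace (GraphEnds.WithEnds G) (GraphEnds.spaceMTop G)) := by
  refine ⟨?_, ?_⟩
  · let _ := GraphEnds.spaceTop G
    have h := GraphEnds.isEndTopology_spaceTop G
    exact ⟨h.t2Space, h.paracompactSpace⟩
  · let _ := GraphEnds.spaceMTop G
    have h := GraphEnds.isEndTopology_spaceMTop G
    exact ⟨h.t2Space, h.paracompactSpace⟩
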